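/- **Setting.** Let $d\in\mathbb N$, let $M\ge 0$ and let $1\le T_1<\dots<T_M$ be integers. Let $\mathcal X$ be a set of sequences $X=(x_t)_{t\in\mathbb Z}$ in $\mathbb R^d$ with $\|x_t\|_2\le 1$ for all $t$, and put $K=\{(z_0,\dots,z_M)\in(\mathbb R^{d})^{M+1}:\|z_i\|_2\le 1 \text{ for all } i\}$. For a function $f$ on $K$ and $q\in[1,\infty]$ let $$\|f\|_{\mathcal B}=\inf_\rho\big\|\,|a|(\|b\|_1+|c|)\,\big\|_{L^q(\rho)},$$ where $\rho$ runs over the probability measures on $\mathbb R\times\mathbb R^{(M+1)d}\times\mathbb R$ with $f(z)=\int a\,\sigma(b^\top z+c)\,d\rho(a,b,c)$ for all $z\in K$, and $\sigma(u)=\max(u,0)$. Assume that $f$ is continuous with $\|f\|_{\mathcal B}<\infty$ and that $f$ is Lipschitz on $K$ for the Euclidean norm, with least Lipschitz constant $\|f\|_{\rm Lip}$. The target is $\mathbf H_t(X)=f(x_t,x_{t-T_1},\dots,x_{t-T_M})$. Let $\phi_{\rm lin}(z)=-z$ for $z\ge 0$ and $\phi_{\log}(z)=-\log z$ for $z\ge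 1$, both being $-\infty$ for all other integers $z$. For ${\rm type}\in\{{\rm lin},\log\}$, a one-layer dot-product-free Transformer with $H$ heads, width $m$ and type-RPE is a map of the form $$x^{(0)}_t=W_Ex_t+b_E\in\mathbb R^D,\qquad y_t=x^{(0)}_t+W_O\sum_{h=1}^H\sum_{s\ge 0}\frac{e^{p_h\phi_{\rm type}(s)}}{\sum_{j\ge 0}e^{p_h\phi_{\rm type}(j)}}\,W_V^{(h)}x^{(0)}_{t-s},\qquad \mathbf{TF}_t(X)=\sum_{k=1}^m a_k\,\sigma(b_k^\top y_t+c_k),$$ with any embedding dimension $D$, real matrices and vectors of suitable sizes, and $p_h>0$ such that the normalising sums are finite (that is, $p_h>1$ if the type is $\log$). **Theorem.** There are absolute constants $A>0$ and $\kappa\in\mathbb N$, and for each $n$ a constant $C(n)>0$ depending only on $n$, such that for all $d,M,(T_i),\mathcal X,q,f$ as above, both types, and all integers $n,H,m\ge 1$ there is a one-layer dot-product-free Transformer $\mathbf{TF}$ with $H$ heads, width $m$ and type-RPE such that $$\sup_{t\in\mathbb Z}\ \sup_{X\in\mathcal X}\ |\mathbf H_t(X)-\mathbf{TF}_t(X)|\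 \le\ A\sqrt{M+1}\,(1+\log m)^{\kappa}\,\frac{\|f\|_{\mathcal B}}{\sqrt m}+\|f\|_{\rm Lip}\,\mathcal E_{\rm Attn},$$ $$\mathcal E_{\rm Attn}=\frac{C(n)}{H^n}\Big(\sum_{i=1}^M e^{0.01T_i}\Big)^{n+1}\ \text{ for lin},\qquad \mathcal E_{\rm Attn}=\frac{C(n)}{H^n}\Big(\sum_{i=1}^M T_i^{1.01}\Big)^{n+1}\ \text{ for }\log .$$ -/

import Mathlib

open scoped ENNReal NNReal Matrix
open MeasureTheory

noncomputable section

/-- The vectors of `ℝ^{kd}`, seen as `k` consecutive blocks (tokens) in `ℝ^d`, with the Euclidean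
norm. -/
abbrev BlockVec (k d : ℕ) : Type := EuclideanSpace ℝ (Fin k × Fin d)

/-- Bi-infinite sequences of tokens in `ℝ^d`. -/
abbrev TokenSeq (d : ℕ) : Type := ℤ → EuclideanSpace ℝ (Fin d)

/-! ### Barron functions and Lipschitz functions -/

/-- `f(x) = ∫ a σ(bᵀx + c) ρ(da, db, dc)` for every `x ∈ X`, where `σ` is the ReLU. -/
def IsBarronRepresentation {ι : Type} [Fintype ι] (X : Set (EuclideanSpace ℝ ι))
    (f : EuclideanSpace ℝ ι → ℝ) (ρ : Measure (ℝ × EuclideanSpace ℝ ι × ℝ)) : Prop :=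
  ∀ x ∈ X, f x = ∫ w, w.1 * max ((∑ i, w.2.1 i * x i) + w.2.2) 0 ∂ρ

/-- The Barron norm `‖f‖_{B_p}` of `f` on the domain `X`: the infimum, over all probability
measures `ρ` representing `f` on `X`, of the `L^p(ρ)` norm of `|a| (‖b‖₁ + |c|)`.
It is `∞` when there is no representation with a finite `L^p` norm. (If the `L^p` norm is finite
and `1 ≤ p`, then the representing integral converges absolutely.) -/
def barronNorm {ι : Type} [Fintype ι] (p : ℝ≥0∞) (X : Set (EuclideanSpace ℝ ι))
    (f : EuclideanSpace ℝ ι → ℝ) : ℝ≥0∞ :=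
  ⨅ (ρ : Measure (ℝ × EuclideanSpace ℝ ι × ℝ)) (_ : IsProbabilityMeasure ρ)
    (_ : IsBarronRepresentation X f ρ),
    eLpNorm (fun w => |w.1| * ((∑ i, |w.2.1 i|) + |w.2.2|)) p ρ

/-- `f` belongs to the Barron space on the domain `X`. -/
def MemBarron {ι : Type} [Fintype ι] (p : ℝ≥0∞) (X : Set (EuclideanSpace ℝ ι))
    (f : EuclideanSpace ℝ ι → ℝ) : Prop :=
  ContinuousOn f X ∧ barronNorm p X f < ∞

/-- The smallest Lipschitz constant of `f` on `X` (used for Lipschitz `f` only). -/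
def lipNorm {ι : Type} [Fintype ι] (X : Set (EuclideanSpace ℝ ι))
    (f : EuclideanSpace ℝ ι → ℝ) : ℝ≥0 :=
  sInf {L : ℝ≥0 | LipschitzOnWith L f X}

/-! ### Targets with fixed, long but sparse memories -/

/-- The lags `0, T₁, …, T_M`. -/
def lags {M : ℕ} (T : Fin M → ℕ) : Fin (M + 1) → ℕ := Fin.cons 0 T

/-- The concatenation `(x_t, x_{t-T₁}, …, x_{t-T_M})`. -/
def memoryVec {d M : ℕ} (T : Fin M → ℕ) (X : TokenSeq d) (t : ℤ) : BlockVec (M + 1) d :=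
  WithLp.toLp 2 fun ij => X (t - (lags T ij.1 : ℤ)) ij.2

/-- The target `H_t(X) = f(x_t, x_{t-T₁}, …, x_{t-T_M})`. -/
def fixedMemoryTarget {d M : ℕ} (T : Fin M → ℕ) (f : BlockVec (M + 1) d → ℝ)
    (X : TokenSeq d) (t : ℤ) : ℝ :=
  f (memoryVec T X t)

/-- The vectors all of whose blocks have Euclidean norm at most `1`: the domain of the readout
function, as the tokens are in the unit ball. -/
def blockUnitBalls (k d : ℕ) : Set (BlockVec k d) :=
  {z | ∀ i, ∑ j, z (i, j) ^ 2 ≤ 1}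

/-- `|||F - G||| = sup_t sup_{X ∈ 𝒳} |F_t(X) - G_t(X)|`, as an extended real. -/
def seqDist {d : ℕ} (𝒳 : Set (TokenSeq d)) (F G : TokenSeq d → ℤ → ℝ) : ℝ≥0∞ :=
  ⨆ (t : ℤ) (X : TokenSeq d) (_ : X ∈ 𝒳), ‖F X t - G X t‖ₑ

/-! ### One-layer Transformers with relative positional encoding -/

/-- The two types of relative positional encoding. -/
inductive RPEType : Type
  | lin
  | log

/-- `φ_lin(z) = -z` for `z ≥ 0` and `φ_log(z) = -log z` for `z ≥ 1`; both are `-∞` otherwise. -/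
def rpe : RPEType → ℤ → EReal
  | .lin, z => if 0 ≤ z then ((-(z : ℝ) : ℝ) : EReal) else ⊥
  | .log, z => if 1 ≤ z then ((-Real.log (z : ℝ) : ℝ) : EReal) else ⊥

/-- The parameters of a one-layer Transformer with token dimension `d`, embedding dimension `D`,
`H` attention heads, feed-forward width `m` and scalar output. -/
structure OneLayerTransformer (d D H m : ℕ) where
  /-- embedding matrix -/
  WE : Matrix (Fin D) (Fin d) ℝ
  /-- embedding bias -/
  bE : Fin D → ℝ
  /-- query matrices -/
  WQ : Fin H → Matrix (Fin D) (Fin D) ℝ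
  /-- key matrices -/
  WK : Fin H → Matrix (Fin D) (Fin D) ℝ
  /-- value matrices -/
  WV : Fin H → Matrix (Fin D) (Fin D) ℝ
  /-- output matrix -/
  WO : Matrix (Fin D) (Fin D) ℝ
  /-- coefficients of the relative positional encoding -/
  p : Fin H → ℝ
  p_pos : ∀ h, 0 < p h
  /-- outer weights of the feed-forward layer -/
  a : Fin m → ℝ
  /-- inner weights of the feed-forward layer -/
  b : Fin m → Fin D → ℝ
  /-- biases of the feed-forward layer -/
  c : Fin m → ℝ

namespace OneLayerTransformer

variable {d D H m : ℕ} (θ : OneLayerTransformer d D H m)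

/-- The embedded tokens `x_t⁽⁰⁾ = W_E x_t + b_E`. -/
def embed (X : TokenSeq d) (t : ℤ) : Fin D → ℝ :=
  θ.WE *ᵥ (X t).ofLp + θ.bE

/-- The exponential of the attention logit of head `h` at position `t` for the token at lag `s`:
`exp(⟨W_Q x_t, W_K x_{t-s}⟩ + p φ(s))`. -/
def score (ty : RPEType) (h : Fin H) (x : ℤ → Fin D → ℝ) (t : ℤ) (s : ℕ) : ℝ≥0∞ :=
  EReal.exp ((((θ.WQ h *ᵥ x t) ⬝ᵥ (θ.WK h *ᵥ x (t - s)) : ℝ) : EReal)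
    + (θ.p h : EReal) * rpe ty (s : ℤ))

/-- The softmax weight of head `h` at position `t` for the token at lag `s`. -/
def attnWeight (ty : RPEType) (h : Fin H) (x : ℤ → Fin D → ℝ) (t : ℤ) (s : ℕ) : ℝ :=
  (θ.score ty h x t s / ∑' j : ℕ, θ.score ty h x t j).toReal

/-- The multi-head attention `W_O ∑_h ∑_s (softmax weight) W_V x_{t-s}`. -/
def attn (ty : RPEType) (x : ℤ → Fin D → ℝ) (t : ℤ) : Fin D → ℝ :=
  θ.WO *ᵥ ∑ h, ∑' s : ℕ, θ.attnWeight ty h x t s • (θ.WV h *ᵥ x (t - s))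

/-- The two-layer ReLU network of width `m` of the feed-forward layer. -/
def ffn (y : Fin D → ℝ) : ℝ :=
  ∑ k, θ.a k * max (θ.b k ⬝ᵥ y + θ.c k) 0

/-- The map computed by the Transformer: embedding, attention with residual connection, and
feed-forward layer without residual connection (as it is the last one). -/
def output (ty : RPEType) (X : TokenSeq d) (t : ℤ) : ℝ :=
  θ.ffn (θ.embed X t + θ.attn ty (θ.embed X) t)

/-- The softmax normalisation of every head is finite. For `lin` this always holds; for `log` it
says that all the coefficients `p` are greater than `1`. -/
def Normalizable (ty : RPEType) : Prop :=
  ∀ h, ∑' s : ℕ, EReal.exp ((θ.p h : EReal) * rpe ty (s : ℤ)) ≠ ∞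

end OneLayerTransformer

/-- The maps computed by the one-layer, `H`-head, `m`-width, dot-product-free
Transformers (`W_Q = W_K = 0`) with relative positional encoding of type `ty`. -/
def dpfTransformers (d H m : ℕ) (ty : RPEType) : Set (TokenSeq d → ℤ → ℝ) :=
  {F | ∃ (D : ℕ) (θ : OneLayerTransformer d D H m),
    (∀ h, θ.WQ h = 0 ∧ θ.WK h = 0) ∧ θ.Normalizable ty ∧ F = θ.output ty}

/-- The size of a lag as it enters the attention error: `e^{0.01 T}` for `lin` and `T^{1.01}` for
`log`. -/
def lagCost : RPEType → ℕ → ℝ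
  | .lin, T => Real.exp (0.01 * (T : ℝ))
  | .log, T => (T : ℝ) ^ (1.01 : ℝ)

end

/-! The attention layer replaces each lagged token by a filtered one, producing a block vector `y`
in the domain `K` of `f`. The error is then at most `|f(memory) - f(y)| + |f(y) - network(y)|`: a
Lipschitz term, governed by the ℓ¹ distance of the filters to point masses, and a uniform
approximation term on `K`.

Approximation (`exists_network_near_barron`). By Hahn–Banach, a suitable rescaling of `f` lies in
the closed convex hull of the unit neurons in `C(K)`, hence is nearly a uniform average of `2 ^ k *
m` of them. Keeping one neuron of each pair, with signs at least as good as the average over all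
signs, halves the number. The loss is controlled by the Rademacher complexity of neurons, which
contraction and the parallelogram law bound by `3 R √n`, with `R` bounding the norms on `K`. The
losses form a geometric series, so the rate is `m^{-1/2}` with no logarithm and no dependence on
`d`.

Attention (`exists_exponent_forall_attention_error`). Let the heads have coefficients `P, 2P, …,
HP`. Their combined kernels are the polynomials of degree at most `H` without constant term in `u(s)
^ P`, where `u = rpeBase ty`. For `T < H`, Lagrange interpolation annihilates the lags below `T` and
gives `1` at `T`; the tail beyond `T` vanishes as `P → ∞`. The error is thus as small as desired,
with one `P` for all such `T`. For `T ≥ H` the zero filter has error `1`, which the bound allows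
because `H ≤ T ≤ 100 * lagCost ty T`. -/

/-! ### Rademacher averages -/

/-- The average of `Φ (h ± g₀ ± ⋯ ± gₙ₋₁)` over all choices of signs. -/
noncomputable def rademacherAvg {V : Type*} [AddCommGroup V] (Φ : V → ℝ) :
    ∀ n : ℕ, (Fin n → V) → V → ℝ
  | 0, _, h => Φ h
  | n + 1, g, h => (rademacherAvg Φ n (fun i => g i.succ) (h + g 0)
      + rademacherAvg Φ n (fun i => g i.succ) (h - g 0)) / 2

section Rademacher

variable {V W : Type*} [AddCommGroup V] [AddCommGroup W]

theorem rademacherAvg_mono {Φ Ψ : V → ℝ} (hΦ : ∀ v, Φ v ≤ Ψ v) (n : ℕ) (g : Fin n → V) (h : V) :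
    rademacherAvg Φ n g h ≤ rademacherAvg Ψ n g h := by
  induction n generalizing h with
  | zero => exact hΦ h
  | succ n ih =>
    have h1 := ih (fun i => g i.succ) (h + g 0)
    have h2 := ih (fun i => g i.succ) (h - g 0)
    simp only [rademacherAvg]
    linarith

theorem rademacherAvg_add (Φ Ψ : V → ℝ) (n : ℕ) (g : Fin n → V) (h : V) :
    rademacherAvg (fun v => Φ v + Ψ v) n g h
      = rademacherAvg Φ n g h + rademacherAvg Ψ n g h := by
  induction n generalizing h with
  | zero => rfl
  | succ n ih => simp only [rademacherAvg, ih]; ring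

theorem rademacherAvg_mul_add_const (Φ : V → ℝ) (a c : ℝ) (n : ℕ) (g : Fin n → V) (h : V) :
    rademacherAvg (fun v => a * Φ v + c) n g h = a * rademacherAvg Φ n g h + c := by
  induction n generalizing h with
  | zero => rfl
  | succ n ih => simp only [rademacherAvg, ih]; ring

theorem rademacherAvg_comp (L : V →+ W) (Φ : W → ℝ) (n : ℕ) (g : Fin n → V) (h : V) :
    rademacherAvg (fun v => Φ (L v)) n g h = rademacherAvg Φ n (fun i => L (g i)) (L h) := by
  induction n generalizing h with
  | zero => rfl
  | succ n ih => simp only [rademacherAvg, ih, map_add, map_sub]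

/-- The parallelogram identity makes the cross terms cancel when a sign is averaged out. -/
theorem rademacherAvg_quadratic {Q : V → ℝ}
    (hQ : ∀ u v, Q (u + v) + Q (u - v) = 2 * (Q u + Q v)) (n : ℕ) (g : Fin n → V) (h : V) :
    rademacherAvg Q n g h = Q h + ∑ i, Q (g i) := by
  induction n generalizing h with
  | zero => simp [rademacherAvg]
  | succ n ih =>
    simp only [rademacherAvg, ih, Fin.sum_univ_succ]
    linarith [hQ h (g 0)]

theorem rademacherAvg_sub_le {Φ : V → ℝ} (hΦ : ∀ u v, Φ (u - v) ≤ Φ u + Φ v) (n : ℕ)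
    (g g' : Fin n → V) (h h' : V) :
    rademacherAvg Φ n (fun i => g i - g' i) (h - h')
      ≤ rademacherAvg Φ n g h + rademacherAvg Φ n g' h' := by
  induction n generalizing h h' with
  | zero => exact hΦ h h'
  | succ n ih =>
    have h1 := ih (fun i => g i.succ) (fun i => g' i.succ) (h + g 0) (h' + g' 0)
    have h2 := ih (fun i => g i.succ) (fun i => g' i.succ) (h - g 0) (h' - g' 0)
    rw [add_sub_add_comm] at h1
    rw [sub_sub_sub_comm] at h2
    simp only [rademacherAvg]
    linarith

/-- A minimum is at most the mean; the signs are fixed one at a time, each time following the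
smaller half. This replaces any random choice. -/
theorem exists_signs_le_rademacherAvg (Φ : V → ℝ) (n : ℕ) (g : Fin n → V) (h : V) :
    ∃ s : Fin n → Bool, Φ (h + ∑ i, if s i then g i else -g i) ≤ rademacherAvg Φ n g h := by
  induction n generalizing h with
  | zero => exact ⟨fun _ => true, by simp [rademacherAvg]⟩
  | succ n ih =>
    obtain ⟨s, hs⟩ := ih (fun i => g i.succ) (h + g 0)
    obtain ⟨s', hs'⟩ := ih (fun i => g i.succ) (h - g 0)
    simp only [rademacherAvg]
    rcases le_total (rademacherAvg Φ n (fun i => g i.succ) (h + g 0))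
      (rademacherAvg Φ n (fun i => g i.succ) (h - g 0)) with hle | hle
    · refine ⟨Fin.cons true s, ?_⟩
      rw [Fin.sum_univ_succ, ← add_assoc]
      simp only [Fin.cons_zero, Fin.cons_succ, if_true]
      linarith
    · refine ⟨Fin.cons false s', ?_⟩
      rw [Fin.sum_univ_succ, ← add_assoc]
      simp only [Fin.cons_zero, Fin.cons_succ, Bool.false_eq_true, if_false, ← sub_eq_add_neg]
      linarith

/-- Replacing a single direction by a dominating one increases the Rademacher average. -/
theorem rademacherAvg_add_rademacherAvg_le {Φ : V → ℝ} {s u : V}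
    (hsu : ∀ h, Φ (h + s) + Φ (h - s) ≤ Φ (h + u) + Φ (h - u)) (n : ℕ) (g : Fin n → V) (h : V) :
    rademacherAvg Φ n g (h + s) + rademacherAvg Φ n g (h - s)
      ≤ rademacherAvg Φ n g (h + u) + rademacherAvg Φ n g (h - u) := by
  induction n generalizing h with
  | zero => exact hsu h
  | succ n ih =>
    have h1 := ih (fun i => g i.succ) (h + g 0)
    have h2 := ih (fun i => g i.succ) (h - g 0)
    simp only [rademacherAvg]
    simp only [add_sub_right_comm, add_right_comm, sub_right_comm] at h1 h2 ⊢
    linarith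

/-- Directions are exchanged one by one, so a comparison for a single sign, uniform in the base
point `h`, suffices. -/
theorem rademacherAvg_le_of_forall {Φ : V → ℝ} (n : ℕ) {s u : Fin n → V}
    (hsu : ∀ i h, Φ (h + s i) + Φ (h - s i) ≤ Φ (h + u i) + Φ (h - u i)) (h : V) :
    rademacherAvg Φ n s h ≤ rademacherAvg Φ n u h := by
  induction n generalizing h with
  | zero => exact le_rfl
  | succ n ih =>
    have h1 := ih (fun i => hsu i.succ) (h + s 0)
    have h2 := ih (fun i => hsu i.succ) (h - s 0)
    have h3 := rademacherAvg_add_rademacherAvg_le (hsu 0) n (fun i => u i.succ) h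
    simp only [rademacherAvg]
    linarith

end Rademacher

/-! ### Contraction principle and Rademacher complexity in `C(Z, ℝ)` -/

section Contraction

variable {Z : Type*} [TopologicalSpace Z] [CompactSpace Z]

theorem ContinuousMap.le_iSup_apply (h : C(Z, ℝ)) (z : Z) : h z ≤ ⨆ z, h z :=
  le_ciSup (isCompact_range h.continuous).bddAbove z

variable [Nonempty Z]

/-- One step of the Ledoux–Talagrand contraction principle. -/
theorem ContinuousMap.iSup_add_iSup_sub_le {s u : C(Z, ℝ)}
    (hsu : ∀ z z', |s z - s z'| ≤ |u z - u z'|) (h : C(Z, ℝ)) :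
    (⨆ z, (h + s) z) + (⨆ z, (h - s) z) ≤ (⨆ z, (h + u) z) + ⨆ z, (h - u) z := by
  rw [← le_sub_iff_add_le]
  refine ciSup_le fun z => ?_
  rw [le_sub_comm]
  refine ciSup_le fun z' => ?_
  have h1 := (h + u).le_iSup_apply z
  have h2 := (h - u).le_iSup_apply z
  have h3 := (h + u).le_iSup_apply z'
  have h4 := (h - u).le_iSup_apply z'
  have h5 := hsu z z'
  have h6 := le_abs_self (s z - s z')
  simp only [ContinuousMap.add_apply, ContinuousMap.sub_apply] at h1 h2 h3 h4 ⊢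
  -- The sign of `u z - u z'` decides which of the two points is tested in the supremum of `h + u`
  -- and which in that of `h - u`.
  rcases abs_cases (u z - u z') with ⟨h7, -⟩ | ⟨h7, -⟩ <;> linarith

variable {E : Type*} [NormedAddCommGroup E] [InnerProductSpace ℝ E]

/-- The linear functional `z ↦ ⟪b, ζ z⟫`, additively in `b`. -/
noncomputable def innerContinuousMap (ζ : C(Z, E)) : E →+ C(Z, ℝ) where
  toFun b := ⟨fun z => inner ℝ b (ζ z), by fun_prop⟩
  map_zero' := by ext; simp
  map_add' b b' := by ext; simp [inner_add_left]

/-- By AM–GM, `‖v‖ ≤ ‖v‖² / (2√n) + √n / 2`, and the average of `‖v‖²` is exactly `∑ ‖b i‖² ≤ n`. -/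
theorem rademacherAvg_norm_le {n : ℕ} (hn : 1 ≤ n) (b : Fin n → E) (hb : ∀ i, ‖b i‖ ≤ 1) :
    rademacherAvg (fun v => ‖v‖) n b 0 ≤ √n := by
  have hs : 0 < √(n : ℝ) := Real.sqrt_pos.2 (by exact_mod_cast hn)
  have key : ∀ v : E, ‖v‖ ≤ (2 * √n)⁻¹ * ‖v‖ ^ 2 + √n / 2 := by
    intro v
    have : (2 * √n)⁻¹ * ‖v‖ ^ 2 + √n / 2 - ‖v‖ = (‖v‖ - √n) ^ 2 / (2 * √n) := by
      field_simp; ring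
    have : 0 ≤ (‖v‖ - √n) ^ 2 / (2 * √n) := by positivity
    linarith
  refine (rademacherAvg_mono key n b 0).trans ?_
  rw [rademacherAvg_mul_add_const (fun v : E => ‖v‖ ^ 2)]
  rw [rademacherAvg_quadratic]
  · have h1 : ∑ i, ‖b i‖ ^ 2 ≤ n := by
      calc ∑ i, ‖b i‖ ^ 2 ≤ ∑ _i : Fin n, (1 : ℝ) :=
            Finset.sum_le_sum fun i _ => pow_le_one₀ (norm_nonneg _) (hb i)
        _ = n := by simp
    have h2 : (2 * √n)⁻¹ * (n : ℝ) = √n / 2 := by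
      have := Real.sq_sqrt (Nat.cast_nonneg n : (0 : ℝ) ≤ n)
      field_simp
      linarith
    have h3 := mul_le_mul_of_nonneg_left h1 (by positivity : 0 ≤ (2 * √n)⁻¹)
    simp only [norm_zero]
    norm_num at h3 ⊢
    norm_num at h2
    linarith
  · intro u v
    have := parallelogram_law_with_norm ℝ u v
    nlinarith

/-- After contraction only linear functionals remain, and the supremum of `⟪v, ζ z⟫` over `z` is at
most `R ‖v‖`. -/
theorem rademacherAvg_iSup_le {n : ℕ} (hn : 1 ≤ n) {R : ℝ} (hR : 0 ≤ R) (ζ : C(Z, E))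
    (hζ : ∀ z, ‖ζ z‖ ≤ R) (s : Fin n → C(Z, ℝ)) (b : Fin n → E) (hb : ∀ i, ‖b i‖ ≤ 1)
    (hs : ∀ i z z', |s i z - s i z'| ≤ |inner ℝ (b i) (ζ z) - inner ℝ (b i) (ζ z')|) :
    rademacherAvg (fun h : C(Z, ℝ) => ⨆ z, h z) n s 0 ≤ R * √n := by
  refine (rademacherAvg_le_of_forall n (u := fun i => innerContinuousMap ζ (b i))
    (fun i h => ContinuousMap.iSup_add_iSup_sub_le (hs i) h) 0).trans ?_
  rw [← map_zero (innerContinuousMap ζ), ← rademacherAvg_comp]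
  have key : ∀ v : E, (⨆ z, (innerContinuousMap ζ v) z) ≤ R * ‖v‖ + 0 := by
    intro v
    refine ciSup_le fun z => ?_
    have h1 : inner ℝ v (ζ z) ≤ ‖v‖ * ‖ζ z‖ := real_inner_le_norm v (ζ z)
    have h2 := mul_le_mul_of_nonneg_left (hζ z) (norm_nonneg v)
    change inner ℝ v (ζ z) ≤ _
    linarith
  refine (rademacherAvg_mono key n b 0).trans ?_
  rw [rademacherAvg_mul_add_const (fun v : E => ‖v‖), add_zero]
  exact mul_le_mul_of_nonneg_left (rademacherAvg_norm_le hn b hb) hR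

/-- The Rademacher complexity of functions that are contractions of linear functionals. -/
theorem rademacherAvg_uniform_norm_le {n : ℕ} (hn : 1 ≤ n) {R : ℝ} (hR : 1 ≤ R) (ζ : C(Z, E))
    (hζ : ∀ z, ‖ζ z‖ ≤ R) (s : Fin n → C(Z, ℝ)) (b : Fin n → E) (hb : ∀ i, ‖b i‖ ≤ 1)
    (hs : ∀ i z z', |s i z - s i z'| ≤ |inner ℝ (b i) (ζ z) - inner ℝ (b i) (ζ z')|)
    (z₀ : Z) (hz₀ : ∀ i, |s i z₀| ≤ 1) :
    rademacherAvg (fun h : C(Z, ℝ) => ‖h‖) n s 0 ≤ 3 * R * √n := by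
  -- Contraction handles one-sided suprema only. Of `sup h` and `sup (-h)` one may be negative, but
  -- neither is below `-|h z₀|`, so adding `|h z₀|` repairs the bound.
  have key : ∀ h : C(Z, ℝ), ‖h‖ ≤ (|h z₀| + ⨆ z, h z) + ⨆ z, (-h) z := by
    intro h
    have h0 := h.le_iSup_apply z₀
    have h0' := (-h).le_iSup_apply z₀
    simp only [ContinuousMap.neg_apply] at h0'
    rw [ContinuousMap.norm_le_of_nonempty]
    intro z
    have h1 := h.le_iSup_apply z
    have h1' := (-h).le_iSup_apply z
    simp only [ContinuousMap.neg_apply] at h1' ⊢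
    have h2 := neg_abs_le (h z₀)
    have h3 := le_abs_self (h z₀)
    rw [Real.norm_eq_abs]
    refine abs_le.2 ⟨?_, ?_⟩ <;> linarith
  refine (rademacherAvg_mono key n s 0).trans ?_
  rw [rademacherAvg_add, rademacherAvg_add]
  have h1 : rademacherAvg (fun h : C(Z, ℝ) => |h z₀|) n s 0 ≤ √n := by
    let L : C(Z, ℝ) →+ ℝ := ⟨⟨fun h => h z₀, rfl⟩, fun _ _ => rfl⟩
    have := rademacherAvg_comp L (fun v : ℝ => ‖v‖) n s 0
    rw [map_zero] at this
    exact this.trans_le (rademacherAvg_norm_le hn _ hz₀)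
  have h2 := rademacherAvg_iSup_le hn (by linarith) ζ hζ s b hb hs
  have h3 : rademacherAvg (fun h : C(Z, ℝ) => ⨆ z, (-h) z) n s 0 ≤ R * √n := by
    have := rademacherAvg_comp (negAddMonoidHom : C(Z, ℝ) →+ C(Z, ℝ))
      (fun h : C(Z, ℝ) => ⨆ z, h z) n s 0
    rw [map_zero] at this
    refine this.trans_le (rademacherAvg_iSup_le hn (by linarith) ζ hζ _ b hb ?_)
    intro i z z'
    have := hs i z z'
    rw [abs_sub_comm] at this
    convert this using 2
    simp
    ring
  nlinarith [Real.sqrt_nonneg (n : ℝ)]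

end Contraction

/-! ### Sparse averages by repeated halving -/

section Halving

variable {V : Type*} [NormedAddCommGroup V] [NormedSpace ℝ V] {S : Set V} {B : ℝ}

/-- Choosing one element of each pair changes the average by a signed sum of half-differences,
divided by `n`. Some signs do as well as the Rademacher average, which is at most `2 B √n` by
splitting the differences. -/
theorem exists_half_average_sub_le
    (hB : ∀ (n : ℕ) (s : Fin n → V), 1 ≤ n → (∀ i, s i ∈ S) →
      rademacherAvg (fun v => ‖v‖) n s 0 ≤ B * √n)
    {n : ℕ} (hn : 1 ≤ n) (g : Fin n × Bool → V) (hg : ∀ i, g i ∈ S) :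
    ∃ g' : Fin n → V, (∀ i, g' i ∈ S) ∧
      ‖(n : ℝ)⁻¹ • ∑ i, g' i - (2 * n : ℝ)⁻¹ • ∑ i, g i‖ ≤ B * (√n)⁻¹ := by
  have hn0 : (0 : ℝ) < n := by exact_mod_cast hn
  obtain ⟨σ, hσ⟩ := exists_signs_le_rademacherAvg (fun v : V => ‖v‖) n
    (fun i => g (i, true) - g (i, false)) 0
  have h1 := rademacherAvg_sub_le (Φ := fun v : V => ‖v‖) norm_sub_le n
    (fun i => g (i, true)) (fun i => g (i, false)) 0 0
  rw [sub_zero] at h1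
  have h2 := hB n (fun i => g (i, true)) hn fun i => hg _
  have h3 := hB n (fun i => g (i, false)) hn fun i => hg _
  refine ⟨fun i => g (i, σ i), fun i => hg _, ?_⟩
  have h4 : (n : ℝ)⁻¹ • ∑ i, g (i, σ i) - (2 * n : ℝ)⁻¹ • ∑ i, g i
      = (2 * n : ℝ)⁻¹ • ∑ i, if σ i then g (i, true) - g (i, false)
          else -(g (i, true) - g (i, false)) := by
    have h5 : (n : ℝ)⁻¹ = (2 * n : ℝ)⁻¹ * 2 := by field_simp
    rw [h5, mul_smul, ← smul_sub, Fintype.sum_prod_type, Finset.smul_sum,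
      ← Finset.sum_sub_distrib]
    congr 1
    refine Finset.sum_congr rfl fun i _ => ?_
    rw [Fintype.sum_bool, two_smul]
    cases σ i <;> simp
  rw [h4, norm_smul, Real.norm_of_nonneg (by positivity)]
  rw [zero_add] at hσ
  calc (2 * n : ℝ)⁻¹ * ‖_‖ ≤ (2 * n : ℝ)⁻¹ * (2 * (B * √n)) :=
        mul_le_mul_of_nonneg_left (by linarith) (by positivity)
    _ = B * (√n)⁻¹ := by
        have hsq := Real.sq_sqrt hn0.le
        have : 0 < √(n : ℝ) := Real.sqrt_pos.2 hn0
        field_simp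
        rw [hsq, mul_comm]

/-- Halving is iterated; the bound is written as a difference so that it telescopes and stays
bounded in `k`. -/
theorem exists_average_sub_average_le (hB0 : 0 ≤ B)
    (hB : ∀ (n : ℕ) (s : Fin n → V), 1 ≤ n → (∀ i, s i ∈ S) →
      rademacherAvg (fun v => ‖v‖) n s 0 ≤ B * √n)
    {n : ℕ} (hn : 1 ≤ n) (k : ℕ) (g : Fin (2 ^ k * n) → V) (hg : ∀ i, g i ∈ S) :
    ∃ g' : Fin n → V, (∀ i, g' i ∈ S) ∧
      ‖(n : ℝ)⁻¹ • ∑ i, g' i - (2 ^ k * n : ℝ)⁻¹ • ∑ i, g i‖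
        ≤ 4 * B * ((√n)⁻¹ - (√(2 ^ k * n))⁻¹) := by
  have hn0 : (0 : ℝ) < n := by exact_mod_cast hn
  induction k with
  | zero =>
    refine ⟨fun i => g (Fin.cast (by simp) i), fun i => hg _, ?_⟩
    have : ∑ i : Fin n, g (Fin.cast (by simp) i) = ∑ i, g i :=
      Fintype.sum_equiv (finCongr (by simp)) _ _ fun i => rfl
    rw [this]
    simp
  | succ k ih =>
    have e : Fin (2 ^ (k + 1) * n) ≃ Fin (2 ^ k * n) × Bool :=
      Fintype.equivOfCardEq (by simp; ring)
    obtain ⟨g₁, hg₁, h₁⟩ := exists_half_average_sub_le hB (n := 2 ^ k * n)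
      (Nat.one_le_iff_ne_zero.2 (by positivity)) (fun i => g (e.symm i)) fun i => hg _
    obtain ⟨g', hg', h'⟩ := ih g₁ hg₁
    refine ⟨g', hg', ?_⟩
    rw [e.symm.sum_comp g] at h₁
    push_cast at h₁
    have hN : (0 : ℝ) < 2 ^ k * n := by positivity
    rw [show (2 : ℝ) ^ (k + 1) * n = 2 * (2 ^ k * n) by ring]
    set N : ℝ := 2 ^ k * n
    -- The constant `4` comes from `1 / √2 ≤ 3 / 4`, which gives `1 - 1 / √2 ≥ 1 / 4`.
    have h3 : B * (√N)⁻¹ ≤ 4 * B * ((√N)⁻¹ - (√(2 * N))⁻¹) := by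
      have hsq : (√(2 * N))⁻¹ ≤ 3 / 4 * (√N)⁻¹ := by
        rw [Real.sqrt_mul (by norm_num), mul_inv]
        refine mul_le_mul_of_nonneg_right ?_ (by positivity)
        rw [inv_le_comm₀ (by positivity) (by norm_num)]
        exact Real.le_sqrt_of_sq_le (by norm_num)
      nlinarith
    have h4 := norm_sub_le_norm_sub_add_norm_sub ((n : ℝ)⁻¹ • ∑ i, g' i) (N⁻¹ • ∑ i, g₁ i)
      ((2 * N)⁻¹ • ∑ i, g i)
    linarith

/-- A convex combination is almost a uniform average of `2 ^ k * n` elements. -/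
theorem exists_average_near_convexHull (h0 : (0 : V) ∈ S) {v : V} (hv : v ∈ convexHull ℝ S)
    {n : ℕ} (hn : 1 ≤ n) {δ : ℝ} (hδ : 0 < δ) :
    ∃ (k : ℕ) (g : Fin (2 ^ k * n) → V), (∀ i, g i ∈ S) ∧
      ‖v - (2 ^ k * n : ℝ)⁻¹ • ∑ i, g i‖ ≤ δ := by
  rw [convexHull_eq] at hv
  obtain ⟨ι, t, w, s, hw0, hw1, hs, rfl⟩ := hv
  obtain ⟨k, hk⟩ := pow_unbounded_of_one_lt ((∑ i ∈ t, ‖s i‖) / δ) (one_lt_two : (1 : ℝ) < 2)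
  set N : ℕ := 2 ^ k * n with hN
  have hNcast : (2 ^ k * n : ℝ) = N := by rw [hN]; push_cast; rfl
  have hNk : (2 : ℝ) ^ k ≤ N := by
    rw [← hNcast]
    exact le_mul_of_one_le_right (by positivity) (by exact_mod_cast hn)
  have hN0 : (0 : ℝ) < N := lt_of_lt_of_le (by positivity) hNk
  -- The weights are rounded down to multiples of `1 / N`; the slots left over are filled with `0 ∈
  -- S`, which adds nothing to the sum.
  let c : t → ℕ := fun i => ⌊(N : ℝ) * w i⌋₊
  have hc : ∑ i, c i ≤ N := by
    have : ((∑ i, c i : ℕ) : ℝ) ≤ N := by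
      push_cast
      calc ∑ i, (c i : ℝ) ≤ ∑ i : t, (N : ℝ) * w i :=
            Finset.sum_le_sum fun i _ =>
              Nat.floor_le (mul_nonneg hN0.le (hw0 i i.2))
        _ = N := by
            rw [← Finset.mul_sum, Finset.sum_coe_sort t w, hw1, mul_one]
    exact_mod_cast this
  have e : Fin N ≃ (Σ i, Fin (c i)) ⊕ Fin (N - ∑ i, c i) :=
    Fintype.equivOfCardEq (by
      rw [Fintype.card_fin, Fintype.card_sum, Fintype.card_sigma]
      simp only [Fintype.card_fin]
      omega)
  let g : (Σ i, Fin (c i)) ⊕ Fin (N - ∑ i, c i) → V := Sum.elim (fun i => s i.1) fun _ => 0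
  have hg : ∀ j, g j ∈ S := by
    rintro (j | j)
    · exact hs _ j.1.2
    · exact h0
  refine ⟨k, fun i => g (e i), fun i => hg _, ?_⟩
  rw [e.sum_comp g, hNcast]
  have h1 : ∑ i, g i = ∑ i : t, (c i : ℝ) • s i := by
    rw [Fintype.sum_sum_type, Fintype.sum_sigma]
    simp only [g, Sum.elim_inl, Sum.elim_inr, Finset.sum_const_zero, add_zero, Finset.sum_const,
      Finset.card_univ, Fintype.card_fin, Nat.cast_smul_eq_nsmul]
  rw [h1, Finset.centerMass_eq_of_sum_1 _ _ hw1, ← Finset.sum_coe_sort t, Finset.smul_sum,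
    ← Finset.sum_sub_distrib]
  calc ‖∑ i : t, (w i • s i - (N : ℝ)⁻¹ • (c i : ℝ) • s i)‖
      ≤ ∑ i : t, (N : ℝ)⁻¹ * ‖s i‖ := by
        refine norm_sum_le_of_le _ fun i _ => ?_
        rw [smul_smul, ← sub_smul, norm_smul]
        refine mul_le_mul_of_nonneg_right ?_ (norm_nonneg _)
        have h2 : (c i : ℝ) ≤ N * w i := Nat.floor_le (mul_nonneg hN0.le (hw0 i i.2))
        have h3 : (N : ℝ) * w i < c i + 1 := Nat.lt_floor_add_one _
        have h4 : w i - (N : ℝ)⁻¹ * c i = (N : ℝ)⁻¹ * (N * w i - c i) := by field_simp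
        rw [h4, Real.norm_of_nonneg (mul_nonneg (by positivity) (by linarith))]
        exact mul_le_of_le_one_right (by positivity) (by linarith)
    _ = (N : ℝ)⁻¹ * ∑ i ∈ t, ‖s i‖ := by
        rw [← Finset.mul_sum, Finset.sum_coe_sort t fun i => ‖s i‖]
    _ ≤ δ := by
        rw [div_lt_iff₀ hδ] at hk
        rw [inv_mul_le_iff₀ hN0]
        nlinarith

/-- The factor `6` is `1` for leaving the closure, `1` for rounding the weights and `4` for the
halvings. -/
theorem exists_average_near_closure_convexHull (hB0 : 0 < B) (h0 : (0 : V) ∈ S)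
    (hB : ∀ (n : ℕ) (s : Fin n → V), 1 ≤ n → (∀ i, s i ∈ S) →
      rademacherAvg (fun v => ‖v‖) n s 0 ≤ B * √n)
    {v : V} (hv : v ∈ closure (convexHull ℝ S)) {n : ℕ} (hn : 1 ≤ n) :
    ∃ g : Fin n → V, (∀ i, g i ∈ S) ∧ ‖v - (n : ℝ)⁻¹ • ∑ i, g i‖ ≤ 6 * B * (√n)⁻¹ := by
  have hn0 : (0 : ℝ) < n := by exact_mod_cast hn
  have hδ : 0 < B * (√n)⁻¹ := by positivity
  obtain ⟨u, hu, huv⟩ := Metric.mem_closure_iff.1 hv _ hδ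
  obtain ⟨k, g₁, hg₁, h₁⟩ := exists_average_near_convexHull h0 hu hn hδ
  obtain ⟨g, hg, h⟩ := exists_average_sub_average_le hB0.le hB hn k g₁ hg₁
  refine ⟨g, hg, ?_⟩
  rw [dist_eq_norm] at huv
  have h2 : 0 ≤ B * (√(2 ^ k * n : ℝ))⁻¹ := by positivity
  have h3 := norm_sub_le_norm_sub_add_norm_sub v u ((n : ℝ)⁻¹ • ∑ i, g i)
  have h4 := norm_sub_le_norm_sub_add_norm_sub u ((2 ^ k * n : ℝ)⁻¹ • ∑ i, g₁ i)
    ((n : ℝ)⁻¹ • ∑ i, g i)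
  rw [norm_sub_rev ((2 ^ k * n : ℝ)⁻¹ • ∑ i, g₁ i)] at h4
  linarith

end Halving

/-! ### Approximation of Barron functions by ReLU networks -/

section Barron

variable {ι : Type} [Fintype ι]

theorem EuclideanSpace.norm_le_sum_abs (b : EuclideanSpace ℝ ι) : ‖b‖ ≤ ∑ i, |b i| := by
  rw [EuclideanSpace.norm_eq]
  refine Real.sqrt_le_iff.2 ⟨Finset.sum_nonneg fun i _ => abs_nonneg _, ?_⟩
  exact Finset.sum_sq_le_sq_sum_of_nonneg fun i _ => norm_nonneg _

theorem EuclideanSpace.inner_eq_sum_mul (b z : EuclideanSpace ℝ ι) :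
    inner ℝ b z = ∑ i, b i * z i := by
  simp [PiLp.inner_apply, mul_comm]

/-- The single neuron `z ↦ a σ(bᵀz + c)`, continuous on `K`. -/
noncomputable def neuron (K : Set (EuclideanSpace ℝ ι)) :
    C(ℝ × EuclideanSpace ℝ ι × ℝ, C(K, ℝ)) :=
  ContinuousMap.curry
    ⟨fun q => q.1.1 * max ((∑ i, q.1.2.1 i * (q.2 : EuclideanSpace ℝ ι) i) + q.1.2.2) 0,
      by fun_prop⟩

theorem neuron_apply (K : Set (EuclideanSpace ℝ ι)) (w : ℝ × EuclideanSpace ℝ ι × ℝ) (z : K) :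
    neuron K w z = w.1 * max ((∑ i, w.2.1 i * (z : EuclideanSpace ℝ ι) i) + w.2.2) 0 :=
  rfl

/-- The weight `|a| (‖b‖₁ + |c|)` of a neuron. -/
noncomputable def pathWeight (w : ℝ × EuclideanSpace ℝ ι × ℝ) : ℝ :=
  |w.1| * ((∑ i, |w.2.1 i|) + |w.2.2|)

theorem pathWeight_nonneg (w : ℝ × EuclideanSpace ℝ ι × ℝ) : 0 ≤ pathWeight w := by
  unfold pathWeight
  positivity

theorem continuous_pathWeight :
    Continuous (pathWeight : ℝ × EuclideanSpace ℝ ι × ℝ → ℝ) := by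
  unfold pathWeight
  fun_prop

/-- The neurons with outer weight in `[-1, 1]` and `‖b‖₁ + |c| ≤ 1`. -/
def unitNeurons (K : Set (EuclideanSpace ℝ ι)) : Set C(K, ℝ) :=
  {s | ∃ w : ℝ × EuclideanSpace ℝ ι × ℝ,
    |w.1| ≤ 1 ∧ (∑ i, |w.2.1 i|) + |w.2.2| ≤ 1 ∧ s = neuron K w}

variable {K : Set (EuclideanSpace ℝ ι)}

theorem zero_mem_unitNeurons : (0 : C(K, ℝ)) ∈ unitNeurons K :=
  ⟨0, by simp, by simp, by ext; simp [neuron_apply]⟩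

/-- Positive homogeneity of the ReLU moves the scale of `(b, c)` to the outer weight. -/
theorem exists_neuron_eq_smul (w : ℝ × EuclideanSpace ℝ ι × ℝ) :
    ∃ s ∈ unitNeurons K, neuron K w = pathWeight w • s := by
  set N : ℝ := (∑ i, |w.2.1 i|) + |w.2.2| with hN
  have hN0 : 0 ≤ N := by positivity
  rcases hN0.eq_or_lt with h | h
  · refine ⟨0, zero_mem_unitNeurons, ?_⟩
    have hb : ∀ i, w.2.1 i = 0 := by
      intro i
      have h1 := Finset.single_le_sum (fun i _ => abs_nonneg (w.2.1 i)) (Finset.mem_univ i)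
      have h2 := abs_nonneg w.2.2
      exact abs_nonpos_iff.1 (by linarith)
    have hc : w.2.2 = 0 := by
      have h1 : 0 ≤ ∑ i, |w.2.1 i| := by positivity
      exact abs_nonpos_iff.1 (by linarith)
    ext z
    simp [neuron_apply, hb, hc]
  · refine ⟨_, ⟨(SignType.sign w.1, N⁻¹ • w.2.1, N⁻¹ * w.2.2), ?_, ?_, rfl⟩, ?_⟩
    · rcases lt_trichotomy w.1 0 with h1 | h1 | h1 <;> simp [h1]
    · simp only [PiLp.smul_apply, smul_eq_mul, abs_mul, ← Finset.mul_sum, ← mul_add,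
        abs_of_pos (inv_pos.2 h)]
      rw [← hN, inv_mul_cancel₀ h.ne']
    · ext z
      simp only [neuron_apply, ContinuousMap.smul_apply, pathWeight, smul_eq_mul, PiLp.smul_apply,
        mul_assoc, ← Finset.mul_sum, ← mul_add]
      rw [← hN]
      have h1 : max (N⁻¹ * ((∑ i, w.2.1 i * (z : EuclideanSpace ℝ ι) i) + w.2.2)) 0
          = N⁻¹ * max ((∑ i, w.2.1 i * (z : EuclideanSpace ℝ ι) i) + w.2.2) 0 := by
        rw [mul_max_of_nonneg _ _ (inv_nonneg.2 h.le), mul_zero]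
      rw [h1]
      have h2 : |w.1| * (SignType.sign w.1 : ℝ) = w.1 := by rw [mul_comm, sign_mul_abs]
      calc _ = (|w.1| * (SignType.sign w.1 : ℝ)) * (N * N⁻¹)
            * max ((∑ i, w.2.1 i * (z : EuclideanSpace ℝ ι) i) + w.2.2) 0 := by
              rw [h2, mul_inv_cancel₀ h.ne', mul_one]
        _ = _ := by ring

/-- On a probability space the `L¹` norm is at most the `L^p` norm, so every exponent reduces to
`1`. -/
theorem exists_representation_of_barronNorm_lt {p : ℝ≥0∞} (hp : 1 ≤ p)
    {f : EuclideanSpace ℝ ι → ℝ} {J : ℝ} (hf : barronNorm p K f < ENNReal.ofReal J) :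
    ∃ ρ : Measure (ℝ × EuclideanSpace ℝ ι × ℝ), IsBarronRepresentation K f ρ ∧
      Integrable pathWeight ρ ∧ ∫ w, pathWeight w ∂ρ ≤ J := by
  simp only [barronNorm, iInf_lt_iff] at hf
  obtain ⟨ρ, hρ, hrep, hlt⟩ := hf
  have hmeas : AEStronglyMeasurable (pathWeight : ℝ × EuclideanSpace ℝ ι × ℝ → ℝ) ρ :=
    continuous_pathWeight.aestronglyMeasurable
  have h1 : eLpNorm pathWeight 1 ρ < ENNReal.ofReal J :=
    (eLpNorm_le_eLpNorm_of_exponent_le hp hmeas).trans_lt hlt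
  have hint : Integrable pathWeight ρ :=
    memLp_one_iff_integrable.1 ⟨hmeas, h1.trans ENNReal.ofReal_lt_top⟩
  refine ⟨ρ, hrep, hint, ?_⟩
  rw [eLpNorm_one_eq_lintegral_enorm, ← ofReal_integral_norm_eq_lintegral_enorm hint,
    ENNReal.ofReal_lt_ofReal_iff_of_nonneg (by positivity)] at h1
  simpa only [Real.norm_of_nonneg (pathWeight_nonneg _)] using h1.le

variable [CompactSpace K]

theorem norm_le_of_mem_unitNeurons {R : ℝ} (hR : 1 ≤ R) (hK : ∀ z ∈ K, ‖z‖ ≤ R)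
    {s : C(K, ℝ)} (hs : s ∈ unitNeurons K) : ‖s‖ ≤ R := by
  obtain ⟨⟨a, b, c⟩, ha, hbc, rfl⟩ := hs
  refine (ContinuousMap.norm_le _ (by linarith)).2 fun z => ?_
  simp only at ha hbc
  rw [neuron_apply, norm_mul, Real.norm_eq_abs, Real.norm_eq_abs, ← one_mul R]
  refine mul_le_mul ha ?_ (abs_nonneg _) zero_le_one
  rw [abs_of_nonneg (le_max_right _ _)]
  refine max_le ?_ (by linarith)
  rw [← EuclideanSpace.inner_eq_sum_mul]
  have h1 := real_inner_le_norm b (z : EuclideanSpace ℝ ι)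
  have h2 := EuclideanSpace.norm_le_sum_abs b
  have h3 := mul_le_mul h2 (hK z z.2) (norm_nonneg _) (by positivity)
  have h4 := le_abs_self c
  have h5 := abs_nonneg c
  simp only
  nlinarith

/-- A function with a Barron representation is in the closed convex hull of rescaled unit
neurons. -/
theorem exists_mem_closure_convexHull_unitNeurons {R : ℝ} (hR : 1 ≤ R) (hK : ∀ z ∈ K, ‖z‖ ≤ R)
    {f : EuclideanSpace ℝ ι → ℝ} {ρ : Measure (ℝ × EuclideanSpace ℝ ι × ℝ)}
    (hρ : IsBarronRepresentation K f ρ) (hint : Integrable pathWeight ρ)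
    {J : ℝ} (hJ : 0 < J) (hρJ : ∫ w, pathWeight w ∂ρ ≤ J) :
    ∃ F ∈ closure (convexHull ℝ (unitNeurons K)), ∀ z : K, f z = J * F z := by
  have hg : Integrable (neuron K) ρ := by
    refine (hint.const_mul R).mono' (neuron K).continuous.aestronglyMeasurable
      (Filter.Eventually.of_forall fun w => ?_)
    obtain ⟨s, hs, hw⟩ := exists_neuron_eq_smul (K := K) w
    rw [hw, norm_smul, Real.norm_of_nonneg (pathWeight_nonneg w), mul_comm]
    exact mul_le_mul_of_nonneg_right (norm_le_of_mem_unitNeurons hR hK hs) (pathWeight_nonneg w)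
  refine ⟨J⁻¹ • ∫ w, neuron K w ∂ρ, ?_, fun z => ?_⟩
  -- A separating functional is at most `u` on unit neurons, with `u ≥ 0` since `0` is one of them.
  -- Integrating against `ρ` bounds it by `u * J` on the integral, a contradiction.
  · by_contra hF
    obtain ⟨ℓ, u, hu, hℓ⟩ := geometric_hahn_banach_closed_point
      (convex_convexHull ℝ (unitNeurons K)).closure isClosed_closure hF
    have hS : ∀ s ∈ unitNeurons K, ℓ s < u := fun s hs =>
      hu s (subset_closure (subset_convexHull ℝ _ hs))
    have hu0 : 0 ≤ u := by simpa using (hS 0 zero_mem_unitNeurons).le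
    have h1 : ℓ (∫ w, neuron K w ∂ρ) ≤ u * J := by
      rw [← ContinuousLinearMap.integral_comp_comm ℓ hg]
      calc ∫ w, ℓ (neuron K w) ∂ρ ≤ ∫ w, u * pathWeight w ∂ρ := by
            refine integral_mono (ℓ.integrable_comp hg) (hint.const_mul u) fun w => ?_
            obtain ⟨s, hs, hw⟩ := exists_neuron_eq_smul (K := K) w
            simp only
            rw [hw, map_smul, smul_eq_mul, mul_comm]
            exact mul_le_mul_of_nonneg_right (hS s hs).le (pathWeight_nonneg w)
        _ = u * ∫ w, pathWeight w ∂ρ := integral_const_mul _ _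
        _ ≤ u * J := mul_le_mul_of_nonneg_left hρJ hu0
    rw [map_smul, smul_eq_mul, lt_inv_mul_iff₀ hJ] at hℓ
    linarith
  · have h1 := ContinuousLinearMap.integral_comp_comm (ContinuousMap.evalCLM ℝ z) hg
    simp only [ContinuousMap.evalCLM_apply] at h1
    rw [ContinuousMap.smul_apply, ← h1, smul_eq_mul, mul_inv_cancel_left₀ hJ.ne']
    exact hρ z z.2

/-- The ReLU is 1-Lipschitz and `‖b‖₂ ≤ ‖b‖₁ ≤ 1`, so neurons are contractions of linear
functionals; the base point is `0`, where a unit neuron has modulus at most `|c| ≤ 1`. -/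
theorem rademacherAvg_unitNeurons_le (h0 : 0 ∈ K) {R : ℝ} (hR : 1 ≤ R) (hK : ∀ z ∈ K, ‖z‖ ≤ R)
    {n : ℕ} (hn : 1 ≤ n) (s : Fin n → C(K, ℝ)) (hs : ∀ i, s i ∈ unitNeurons K) :
    rademacherAvg (fun h : C(K, ℝ) => ‖h‖) n s 0 ≤ 3 * R * √n := by
  have : Nonempty K := ⟨⟨0, h0⟩⟩
  choose w ha hbc hw using hs
  refine rademacherAvg_uniform_norm_le hn hR ⟨Subtype.val, continuous_subtype_val⟩
    (fun z => hK z z.2) s (fun i => (w i).2.1) (fun i => ?_) (fun i z z' => ?_) ⟨0, h0⟩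
    fun i => ?_
  · exact (EuclideanSpace.norm_le_sum_abs _).trans
      (by linarith [hbc i, abs_nonneg (w i).2.2])
  · rw [hw i, neuron_apply, neuron_apply, ← mul_sub, abs_mul]
    rw [← EuclideanSpace.inner_eq_sum_mul, ← EuclideanSpace.inner_eq_sum_mul]
    refine (mul_le_of_le_one_left (abs_nonneg _) (ha i)).trans
      ((abs_max_sub_max_le_abs _ _ _).trans_eq ?_)
    simp
  · rw [hw i, neuron_apply, abs_mul]
    refine (mul_le_of_le_one_left (abs_nonneg _) (ha i)).trans ?_
    have h1 : 0 ≤ ∑ j, |(w i).2.1 j| := by positivity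
    simp only [PiLp.zero_apply, mul_zero, Finset.sum_const_zero, zero_add]
    rw [abs_of_nonneg (le_max_right _ _)]
    exact max_le (by linarith [hbc i, le_abs_self (w i).2.2]) zero_le_one

/-- Uniform approximation of Barron functions at the dimension-free rate `m^{-1/2}`. -/
theorem exists_network_near_barron (h0 : 0 ∈ K) {R : ℝ} (hR : 1 ≤ R) (hK : ∀ z ∈ K, ‖z‖ ≤ R)
    {p : ℝ≥0∞} (hp : 1 ≤ p) {f : EuclideanSpace ℝ ι → ℝ} (hf : barronNorm p K f < ∞)
    {m : ℕ} (hm : 1 ≤ m) :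
    ∃ w : Fin m → ℝ × EuclideanSpace ℝ ι × ℝ, ∀ z ∈ K,
      |f z - ∑ k, (w k).1 * max ((∑ i, (w k).2.1 i * z i) + (w k).2.2) 0|
        ≤ 36 * R * ((barronNorm p K f).toReal / √m) := by
  -- The infimum need not be attained, so `J` must exceed the norm. The choice `J = 2 * b` needs `b
  -- > 0` and gives `36 = 2 * 6 * 3`; when the norm is zero, every `J > 0` is allowed and `f`
  -- vanishes on `K`.
  rcases eq_or_ne (barronNorm p K f) 0 with hz | hz
  · refine ⟨0, fun z hzK => ?_⟩
    have h1 : |f z| ≤ 0 := by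
      refine le_of_forall_pos_le_add fun δ hδ => ?_
      have hJ : 0 < δ / R := by positivity
      obtain ⟨ρ, hrep, hint, hle⟩ := exists_representation_of_barronNorm_lt hp
        (by rw [hz]; exact ENNReal.ofReal_pos.2 hJ)
      obtain ⟨F, hF, hfF⟩ := exists_mem_closure_convexHull_unitNeurons hR hK hrep hint hJ hle
      have hF1 : closure (convexHull ℝ (unitNeurons K)) ⊆ Metric.closedBall 0 R :=
        closure_minimal (convexHull_min (fun s hs => by
          simpa using norm_le_of_mem_unitNeurons hR hK hs) (convex_closedBall _ _))
          Metric.isClosed_closedBall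
      have hF2 : ‖F‖ ≤ R := by simpa using hF1 hF
      have hF3 := (F.norm_coe_le_norm ⟨z, hzK⟩).trans hF2
      rw [hfF ⟨z, hzK⟩, abs_mul, abs_of_pos hJ, zero_add]
      calc δ / R * |F ⟨z, hzK⟩| ≤ δ / R * R := mul_le_mul_of_nonneg_left hF3 hJ.le
        _ = δ := by field_simp
    simpa [hz] using h1
  · set b : ℝ := (barronNorm p K f).toReal with hb
    have hb0 : 0 < b := ENNReal.toReal_pos hz hf.ne
    obtain ⟨ρ, hrep, hint, hle⟩ := exists_representation_of_barronNorm_lt hp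
      (J := 2 * b) (by
        rw [← ENNReal.ofReal_toReal hf.ne, ← hb, ENNReal.ofReal_lt_ofReal_iff (by positivity)]
        linarith)
    obtain ⟨F, hF, hfF⟩ := exists_mem_closure_convexHull_unitNeurons hR hK hrep hint
      (J := 2 * b) (by positivity) hle
    obtain ⟨g, hg, hFg⟩ := exists_average_near_closure_convexHull (B := 3 * R) (by positivity)
      zero_mem_unitNeurons (fun n s hn hs => rademacherAvg_unitNeurons_le h0 hR hK hn s hs) hF hm
    choose w ha hbc hw using hg
    refine ⟨fun k => (2 * b * (m : ℝ)⁻¹ * (w k).1, (w k).2), fun z hzK => ?_⟩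
    have h1 := ((F - (m : ℝ)⁻¹ • ∑ i, g i).norm_coe_le_norm ⟨z, hzK⟩).trans hFg
    have h2 : f z - ∑ k, (2 * b * (m : ℝ)⁻¹ * (w k).1)
          * max ((∑ i, (w k).2.1 i * z i) + (w k).2.2) 0
        = 2 * b * (F - (m : ℝ)⁻¹ • ∑ i, g i) ⟨z, hzK⟩ := by
      rw [hfF ⟨z, hzK⟩, ContinuousMap.sub_apply, ContinuousMap.smul_apply, ContinuousMap.sum_apply]
      simp only [hw, neuron_apply, smul_eq_mul]
      rw [mul_sub, Finset.mul_sum, Finset.mul_sum]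
      congr 1
      exact Finset.sum_congr rfl fun i _ => by ring
    rw [h2, abs_mul, abs_of_pos (by positivity : 0 < 2 * b)]
    calc 2 * b * |(F - (m : ℝ)⁻¹ • ∑ i, g i) ⟨z, hzK⟩| ≤ 2 * b * (6 * (3 * R) * (√m)⁻¹) :=
          mul_le_mul_of_nonneg_left h1 (by positivity)
      _ = 36 * R * (b / √m) := by ring

end Barron

/-! ### Sharp attention kernels -/

section Kernel

/-- The exponential of the relative positional encoding, as a real number. -/
noncomputable def rpeBase : RPEType → ℕ → ℝ
  | .lin, s => Real.exp (-s)
  | .log, s => (s : ℝ)⁻¹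

theorem rpeBase_nonneg (ty : RPEType) (s : ℕ) : 0 ≤ rpeBase ty s := by
  cases ty <;> simp only [rpeBase] <;> positivity

theorem rpeBase_pos (ty : RPEType) {s : ℕ} (hs : 1 ≤ s) : 0 < rpeBase ty s := by
  have : (0 : ℝ) < s := by exact_mod_cast hs
  cases ty <;> simp only [rpeBase] <;> positivity

theorem rpeBase_lt (ty : RPEType) {s t : ℕ} (hs : 1 ≤ s) (hst : s < t) :
    rpeBase ty t < rpeBase ty s := by
  have h0 : (0 : ℝ) < s := by exact_mod_cast hs
  have h1 : (s : ℝ) < t := by exact_mod_cast hst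
  cases ty with
  | lin => exact Real.exp_lt_exp.2 (neg_lt_neg h1)
  | log => exact inv_strictAnti₀ h0 h1

/-- The first alternative is lag `0` for `log`: the convention `0⁻¹ = 0` agrees with `exp(-∞) = 0`,
and strict decrease starts only at lag `1`. -/
theorem rpeBase_eq_zero_or_lt (ty : RPEType) {r t : ℕ} (hrt : r < t) :
    rpeBase ty r = 0 ∨ rpeBase ty t < rpeBase ty r := by
  rcases Nat.eq_zero_or_pos r with rfl | hr
  · cases ty with
    | lin =>
      refine Or.inr (Real.exp_lt_exp.2 (neg_lt_neg ?_))
      exact_mod_cast hrt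
    | log => exact Or.inl (by simp [rpeBase])
  · exact Or.inr (rpeBase_lt ty hr hrt)

theorem rpeBase_le_one (ty : RPEType) (s : ℕ) : rpeBase ty s ≤ 1 := by
  cases ty with
  | lin => simp [rpeBase]
  | log => simpa [rpeBase] using Nat.cast_inv_le_one s

theorem summable_rpeBase_pow (ty : RPEType) {q : ℕ} (hq : 2 ≤ q) :
    Summable fun s => rpeBase ty s ^ q := by
  have h2 : Summable fun s => rpeBase ty s ^ 2 := by
    cases ty with
    | lin =>
      have := summable_geometric_of_lt_one (Real.exp_nonneg (-2))
        (by simp : Real.exp (-2) < 1)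
      refine this.congr fun s => ?_
      simp only [rpeBase, ← Real.exp_nat_mul]
      congr 1
      push_cast
      ring
    | log =>
      have := Real.summable_nat_pow_inv.2 (one_lt_two)
      exact this.congr fun s => by simp [rpeBase]
  refine h2.of_nonneg_of_le (fun s => pow_nonneg (rpeBase_nonneg ty s) _) fun s => ?_
  exact pow_le_pow_of_le_one (rpeBase_nonneg ty s) (rpeBase_le_one ty s) hq

/-- The mass beyond lag `T` of the kernel `u ^ P`, relative to its value at `T`, vanishes as
`P → ∞`. -/
theorem tendsto_tsum_rpeBase_div_pow (ty : RPEType) {T : ℕ} (hT : 1 ≤ T) :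
    Filter.Tendsto (fun P : ℕ => ∑' s : ℕ, (rpeBase ty (s + (T + 1)) / rpeBase ty T) ^ P)
      Filter.atTop (nhds 0) := by
  have hpos := rpeBase_pos ty hT
  set q := rpeBase ty (T + 1) / rpeBase ty T
  have hq0 : 0 ≤ q := div_nonneg (rpeBase_nonneg _ _) hpos.le
  have hq1 : q < 1 := (div_lt_one hpos).2 (rpeBase_lt ty hT (Nat.lt_succ_self T))
  have hsum : ∀ P : ℕ, 2 ≤ P →
      Summable fun s : ℕ => (rpeBase ty (s + (T + 1)) / rpeBase ty T) ^ P := by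
    intro P hP
    simp only [div_pow]
    exact ((summable_nat_add_iff (T + 1)).2 (summable_rpeBase_pow ty hP)).div_const _
  -- Two powers are set aside to keep the series summable for `log`; the remaining `P` supply the
  -- factor `q ^ P`.
  rw [← Filter.tendsto_add_atTop_iff_nat 2]
  set Z := ∑' s : ℕ, (rpeBase ty (s + (T + 1)) / rpeBase ty T) ^ 2
  have hlim : Filter.Tendsto (fun P : ℕ => q ^ P * Z) Filter.atTop (nhds 0) := by
    simpa using (tendsto_pow_atTop_nhds_zero_of_lt_one hq0 hq1).mul_const Z
  refine squeeze_zero (fun P => tsum_nonneg fun s => ?_) (fun P => ?_) hlim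
  · exact pow_nonneg (div_nonneg (rpeBase_nonneg _ _) hpos.le) _
  · rw [← tsum_mul_left]
    refine (hsum _ (by omega)).tsum_le_tsum (fun s => ?_) ((hsum 2 le_rfl).mul_left _)
    have h0 : 0 ≤ rpeBase ty (s + (T + 1)) / rpeBase ty T :=
      div_nonneg (rpeBase_nonneg _ _) hpos.le
    have h1 : rpeBase ty (s + (T + 1)) / rpeBase ty T ≤ q := by
      refine div_le_div_of_nonneg_right ?_ hpos.le
      rcases Nat.eq_zero_or_pos s with rfl | hs
      · rw [zero_add]
      · exact (rpeBase_lt ty (by omega) (by omega)).le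
    rw [pow_add]
    exact mul_le_mul_of_nonneg_right (pow_le_pow_left₀ h0 h1 P) (pow_nonneg h0 2)

/-- Lagrange-type interpolation: a polynomial without constant term in the weights `y` that selects
the lag `T`. -/
theorem exists_coeff_select {y : ℕ → ℝ} {T H : ℕ} (hTH : T < H) (hy0 : ∀ s, 0 ≤ y s)
    (hyT : 0 < y T) (hylt : ∀ s, T < s → y s ≤ y T)
    (hy : ∀ r, r < T → y r = 0 ∨ 2 * y T ≤ y r) :
    ∃ c : Fin H → ℝ, (∀ s, s < T → ∑ h, c h * y s ^ (h + 1 : ℕ) = 0) ∧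
      ∑ h, c h * y T ^ (h + 1 : ℕ) = 1 ∧
      ∀ s, T < s → |∑ h, c h * y s ^ (h + 1 : ℕ)| ≤ 2 ^ T * (y s / y T) := by
  have hne : ∀ r, r < T → y T - y r ≠ 0 := by
    intro r hr
    rcases hy r hr with h | h
    · rw [h, sub_zero]; exact hyT.ne'
    · exact (by linarith : y T - y r < 0).ne
  -- `Q` has degree at most `T ≤ H - 1`, so its coefficients fit on `H` heads. The kernel is `y *
  -- Q(y)`; the prefactor `(y T)⁻¹` compensates the extra `y` at lag `T`.
  let Q : Polynomial ℝ := Polynomial.C (y T)⁻¹ *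
    ∏ r ∈ Finset.range T, (Polynomial.C (y T - y r)⁻¹ * (Polynomial.X - Polynomial.C (y r)))
  have hdeg : Q.natDegree < H := by
    refine lt_of_le_of_lt ?_ hTH
    refine (Polynomial.natDegree_C_mul_le _ _).trans ((Polynomial.natDegree_prod_le _ _).trans ?_)
    refine (Finset.sum_le_card_nsmul _ _ 1 fun r _ => ?_).trans (by simp)
    exact (Polynomial.natDegree_C_mul_le _ _).trans (Polynomial.natDegree_X_sub_C_le _)
  have heval : ∀ s, ∑ h : Fin H, Q.coeff h * y s ^ (h + 1 : ℕ)
      = y s / y T * ∏ r ∈ Finset.range T, ((y T - y r)⁻¹ * (y s - y r)) := by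
    intro s
    have h1 := Polynomial.eval_eq_sum_range' hdeg (y s)
    rw [← Fin.sum_univ_eq_sum_range (fun i => Q.coeff i * y s ^ i)] at h1
    have h2 : Q.eval (y s)
        = (y T)⁻¹ * ∏ r ∈ Finset.range T, ((y T - y r)⁻¹ * (y s - y r)) := by
      simp [Q, Polynomial.eval_prod]
    calc ∑ h : Fin H, Q.coeff h * y s ^ (h + 1 : ℕ) = y s * Q.eval (y s) := by
          rw [h1, Finset.mul_sum]
          exact Finset.sum_congr rfl fun i _ => by rw [pow_succ]; ring
      _ = _ := by rw [h2]; ring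
  refine ⟨fun h => Q.coeff h, fun s hs => ?_, ?_, fun s hs => ?_⟩
  · rw [heval, Finset.prod_eq_zero (Finset.mem_range.2 hs) (by simp), mul_zero]
  · rw [heval, div_self hyT.ne', one_mul]
    exact Finset.prod_eq_one fun r hr => inv_mul_cancel₀ (hne r (Finset.mem_range.1 hr))
  · rw [heval, abs_mul, abs_of_nonneg (div_nonneg (hy0 s) hyT.le), mul_comm]
    refine mul_le_mul_of_nonneg_right ?_ (div_nonneg (hy0 s) hyT.le)
    rw [Finset.abs_prod]
    -- Each factor is at most `2`: it is `y s / y T ≤ 1` when `y r = 0`, and otherwise at most `y r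
    -- / (y r - y T)`, where `y r ≥ 2 * y T`.
    calc ∏ r ∈ Finset.range T, |(y T - y r)⁻¹ * (y s - y r)| ≤ ∏ _r ∈ Finset.range T, (2 : ℝ) := by
          refine Finset.prod_le_prod (fun r _ => abs_nonneg _) fun r hr => ?_
          have hr' := hne r (Finset.mem_range.1 hr)
          rw [abs_mul, abs_inv, inv_mul_le_iff₀ (abs_pos.2 hr')]
          have h1 := hylt s hs
          have h2 := hy0 s
          rcases hy r (Finset.mem_range.1 hr) with h | h
          · rw [h, sub_zero, sub_zero, abs_of_nonneg h2, abs_of_pos hyT]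
            linarith
          · rw [abs_of_nonpos (by linarith), abs_of_neg (by linarith)]
            linarith
      _ = 2 ^ T := by simp

/-- Scaling a nearly sharp kernel so that its total variation is at most one. -/
theorem tsum_abs_scaled_kernel_le {κ : ℕ → ℝ} {T : ℕ} {δ : ℝ} (hδ : 0 < δ) (hκ : Summable κ)
    (hlt : ∀ s, s < T → κ s = 0) (hT : κ T = 1) (htail : ∑' s, |κ (s + (T + 1))| ≤ δ / 2) :
    ∑' s, |(1 + δ / 2)⁻¹ * κ s| ≤ 1 ∧
      ∑' s, |(1 + δ / 2)⁻¹ * κ s - if s = T then 1 else 0| ≤ δ := by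
  -- Scaling costs `1 - l = l * δ / 2` at lag `T`, and the tail costs at most as much again, for a
  -- total of `l * δ ≤ δ`.
  set l : ℝ := (1 + δ / 2)⁻¹
  have hl0 : 0 < l := by positivity
  have hl1 : l * (1 + δ / 2) = 1 := inv_mul_cancel₀ (by positivity)
  have hlδ : 0 < l * δ := mul_pos hl0 hδ
  have hl2 : l ≤ 1 := by linarith
  have hltail := mul_le_mul_of_nonneg_left htail hl0.le
  have hlδ' := mul_le_mul_of_nonneg_right hl2 hδ.le
  constructor
  · rw [← (hκ.mul_left l).abs.sum_add_tsum_nat_add (T + 1), Finset.sum_range_succ,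
      Finset.sum_eq_zero fun s hs => by rw [hlt s (Finset.mem_range.1 hs), mul_zero, abs_zero]]
    simp only [abs_mul, abs_of_pos hl0]
    rw [tsum_mul_left, hT, abs_one]
    linarith
  · have hs : Summable fun s => |l * κ s - if s = T then 1 else 0| := by
      refine ((hκ.mul_left l).sub (summable_of_ne_finset_zero (s := {T}) fun s hs => ?_)).abs
      rw [if_neg (by simpa using hs)]
    rw [← hs.sum_add_tsum_nat_add (T + 1), Finset.sum_range_succ,
      Finset.sum_eq_zero fun s hs => by
        rw [hlt s (Finset.mem_range.1 hs), if_neg (Finset.mem_range.1 hs).ne]; simp]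
    have h1 : ∀ s, |l * κ (s + (T + 1)) - if s + (T + 1) = T then 1 else 0|
        = l * |κ (s + (T + 1))| := by
      intro s
      rw [if_neg (by omega), sub_zero, abs_mul, abs_of_pos hl0]
    simp only [h1]
    rw [tsum_mul_left, hT, if_true, mul_one, abs_sub_comm, abs_of_nonneg (by linarith)]
    linarith

/-- Heads with integer exponents `P, 2P, …, HP`, for `P` large, select any lag `T < H`. -/
theorem eventually_exists_kernel (ty : RPEType) {T H : ℕ} (hT : 1 ≤ T) (hTH : T < H) {δ : ℝ}
    (hδ : 0 < δ) :
    ∀ᶠ P : ℕ in Filter.atTop, ∃ c : Fin H → ℝ,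
      ∑' s, |∑ h, c h * rpeBase ty s ^ (P * (h + 1))| ≤ 1 ∧
      ∑' s, |(∑ h, c h * rpeBase ty s ^ (P * (h + 1))) - if s = T then 1 else 0| ≤ δ := by
  have hpos := rpeBase_pos ty hT
  have hsep : ∀ᶠ P : ℕ in Filter.atTop, ∀ r ∈ Finset.range T,
      rpeBase ty r ^ P = 0 ∨ 2 * rpeBase ty T ^ P ≤ rpeBase ty r ^ P := by
    rw [Filter.eventually_all_finset]
    intro r hr
    rcases rpeBase_eq_zero_or_lt ty (Finset.mem_range.1 hr) with h | h
    · filter_upwards [Filter.eventually_ge_atTop 1] with P hP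
      rw [h]
      exact Or.inl (zero_pow (by omega))
    · have hr0 : 0 < rpeBase ty r := hpos.trans h
      have h1 := tendsto_pow_atTop_nhds_zero_of_lt_one (div_nonneg hpos.le hr0.le)
        ((div_lt_one hr0).2 h)
      filter_upwards [h1.eventually (gt_mem_nhds (by norm_num : (0 : ℝ) < 1 / 2))] with P hP
      rw [div_pow, div_lt_iff₀ (pow_pos hr0 P)] at hP
      exact Or.inr (by linarith)
  have htail := (tendsto_tsum_rpeBase_div_pow ty hT).eventually
    (gt_mem_nhds (by positivity : (0 : ℝ) < δ / 2 / 2 ^ T))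
  filter_upwards [hsep, htail, Filter.eventually_ge_atTop 2] with P hP₁ hP₂ hP₃
  obtain ⟨c, hc₁, hc₂, hc₃⟩ := exists_coeff_select (y := fun s => rpeBase ty s ^ P) hTH
    (fun s => pow_nonneg (rpeBase_nonneg ty s) P) (pow_pos hpos P)
    (fun s hs => pow_le_pow_left₀ (rpeBase_nonneg ty s) (rpeBase_lt ty hT hs).le P)
    (fun r hr => hP₁ r (Finset.mem_range.2 hr))
  simp only [← pow_mul, ← div_pow] at hc₁ hc₂ hc₃
  set κ : ℕ → ℝ := fun s => ∑ h, c h * rpeBase ty s ^ (P * (h + 1))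
  have hκsum : Summable κ := by
    refine summable_sum fun h _ => (summable_rpeBase_pow ty ?_).mul_left _
    exact hP₃.trans (Nat.le_mul_of_pos_right P (Nat.succ_pos _))
  set τ := ∑' s, |κ (s + (T + 1))|
  have hκtail : Summable fun s => |κ (s + (T + 1))| :=
    (summable_nat_add_iff (f := fun s => |κ s|) (T + 1)).2 hκsum.abs
  have hτδ : τ ≤ δ / 2 := by
    have hs : Summable fun s : ℕ => (rpeBase ty (s + (T + 1)) / rpeBase ty T) ^ P := by
      simp only [div_pow]
      exact ((summable_nat_add_iff (f := fun s => rpeBase ty s ^ P) (T + 1)).2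
        (summable_rpeBase_pow ty hP₃)).div_const _
    have h1 : τ ≤ ∑' s : ℕ, 2 ^ T * (rpeBase ty (s + (T + 1)) / rpeBase ty T) ^ P :=
      hκtail.tsum_le_tsum (fun s => hc₃ _ (by omega)) (hs.mul_left _)
    rw [tsum_mul_left] at h1
    rw [lt_div_iff₀ (by positivity)] at hP₂
    linarith
  obtain ⟨h1, h2⟩ := tsum_abs_scaled_kernel_le hδ hκsum hc₁ hc₂ hτδ
  refine ⟨fun h => (1 + δ / 2)⁻¹ * c h, ?_, ?_⟩
  · simp only [mul_assoc, ← Finset.mul_sum]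
    exact h1
  · simp only [mul_assoc, ← Finset.mul_sum]
    exact h2

/-- The heads are shared by all the lags, so a single `P` must serve every `T < H`; finitely many
eventual conditions hold simultaneously. -/
theorem exists_exponent_forall_kernel (ty : RPEType) (H : ℕ) {δ : ℝ} (hδ : 0 < δ) :
    ∃ P : ℕ, 2 ≤ P ∧ ∀ T, 1 ≤ T → T < H → ∃ c : Fin H → ℝ,
      ∑' s, |∑ h, c h * rpeBase ty s ^ (P * (h + 1))| ≤ 1 ∧
      ∑' s, |(∑ h, c h * rpeBase ty s ^ (P * (h + 1))) - if s = T then 1 else 0| ≤ δ := by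
  have h1 : ∀ᶠ P : ℕ in Filter.atTop, ∀ T ∈ Finset.range H, 1 ≤ T → ∃ c : Fin H → ℝ,
      ∑' s, |∑ h, c h * rpeBase ty s ^ (P * (h + 1))| ≤ 1 ∧
      ∑' s, |(∑ h, c h * rpeBase ty s ^ (P * (h + 1))) - if s = T then 1 else 0| ≤ δ := by
    rw [Filter.eventually_all_finset]
    intro T hTH
    by_cases hT : 1 ≤ T
    · filter_upwards [eventually_exists_kernel ty hT (Finset.mem_range.1 hTH) hδ] with P hP _
      exact hP
    · exact Filter.Eventually.of_forall fun P h => absurd h hT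
  obtain ⟨P, hP, hP2⟩ := (h1.and (Filter.eventually_ge_atTop 2)).exists
  exact ⟨P, hP2, fun T hT hTH => hP T (Finset.mem_range.2 hTH) hT⟩

end Kernel

/-! ### The Transformer -/

section Transformer

theorem exp_mul_rpe (ty : RPEType) {q : ℕ} (hq : 1 ≤ q) (s : ℕ) :
    EReal.exp (((q : ℝ) : EReal) * rpe ty (s : ℤ)) = ENNReal.ofReal (rpeBase ty s ^ q) := by
  have hq0 : (0 : ℝ) < q := by exact_mod_cast hq
  cases ty with
  | lin =>
    rw [rpe, if_pos (Int.natCast_nonneg s), ← EReal.coe_mul, EReal.exp_coe, rpeBase,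
      ← Real.exp_nat_mul, Int.cast_natCast]
  | log =>
    rcases Nat.eq_zero_or_pos s with rfl | hs
    · rw [rpe, if_neg (by simp), EReal.coe_mul_bot_of_pos hq0, EReal.exp_bot, rpeBase,
        Nat.cast_zero, inv_zero, zero_pow (by omega), ENNReal.ofReal_zero]
    · have hs0 : (0 : ℝ) < s := by exact_mod_cast hs
      rw [rpe, if_pos (by exact_mod_cast hs), ← EReal.coe_mul, EReal.exp_coe, rpeBase,
        Int.cast_natCast, Real.exp_nat_mul, Real.exp_neg, Real.exp_log hs0]

theorem tsum_exp_mul_rpe (ty : RPEType) {q : ℕ} (hq : 2 ≤ q) :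
    ∑' s : ℕ, EReal.exp (((q : ℝ) : EReal) * rpe ty (s : ℤ))
      = ENNReal.ofReal (∑' s, rpeBase ty s ^ q) := by
  simp only [exp_mul_rpe ty (by omega : 1 ≤ q)]
  exact (ENNReal.ofReal_tsum_of_nonneg (fun s => pow_nonneg (rpeBase_nonneg ty s) q)
    (summable_rpeBase_pow ty hq)).symm

theorem tsum_rpeBase_pow_pos (ty : RPEType) {q : ℕ} (hq : 2 ≤ q) :
    0 < ∑' s, rpeBase ty s ^ q :=
  (summable_rpeBase_pow ty hq).tsum_pos (fun s => pow_nonneg (rpeBase_nonneg ty s) q) 1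
    (pow_pos (rpeBase_pos ty le_rfl) q)

theorem attnWeight_eq {d D H m : ℕ} (θ : OneLayerTransformer d D H m) (ty : RPEType) {h : Fin H}
    (hQ : θ.WQ h = 0) {q : ℕ} (hq : 2 ≤ q) (hp : θ.p h = q) (x : ℤ → Fin D → ℝ) (t : ℤ) (s : ℕ) :
    θ.attnWeight ty h x t s = rpeBase ty s ^ q / ∑' j, rpeBase ty j ^ q := by
  have hscore : ∀ s : ℕ, θ.score ty h x t s
      = EReal.exp (((q : ℝ) : EReal) * rpe ty (s : ℤ)) := by
    intro s
    simp [OneLayerTransformer.score, hQ, hp]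
  rw [OneLayerTransformer.attnWeight]
  simp only [hscore]
  rw [tsum_exp_mul_rpe ty hq, exp_mul_rpe ty (by omega), ENNReal.toReal_div,
    ENNReal.toReal_ofReal (pow_nonneg (rpeBase_nonneg ty s) q),
    ENNReal.toReal_ofReal (tsum_rpeBase_pow_pos ty hq).le]

/-- The Transformer whose embedding puts the token in block `0` and whose head `h`, with positional
coefficient `q h`, contributes `β h i` times its average of the tokens to block `i`. -/
noncomputable def blockTransformer {d M H m : ℕ} (q : Fin H → ℕ) (hq : ∀ h, 2 ≤ q h)
    (β : Fin H → Fin (M + 1) → ℝ) (w : Fin m → ℝ × BlockVec (M + 1) d × ℝ) :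
    OneLayerTransformer d ((M + 1) * d) H m where
  WE a j := if finProdFinEquiv.symm a = (0, j) then 1 else 0
  bE := 0
  WQ _ := 0
  WK _ := 0
  WV h a a' := if a' = finProdFinEquiv (0, (finProdFinEquiv.symm a).2) then
    β h (finProdFinEquiv.symm a).1 else 0
  WO := 1
  p h := q h
  p_pos h := by have := hq h; positivity
  a k := (w k).1
  b k a := (w k).2.1 (finProdFinEquiv.symm a)
  c k := (w k).2.2

/-- The block vector `(x_t, ∑ₛ κ₁(s) x_{t-s}, …, ∑ₛ κ_M(s) x_{t-s})`. -/
noncomputable def filteredVec {d M : ℕ} (κ : Fin M → ℕ → ℝ) (X : TokenSeq d) (t : ℤ) :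
    BlockVec (M + 1) d :=
  WithLp.toLp 2 fun ij =>
    Fin.cons (α := fun _ => ℝ) (X t ij.2) (fun i => ∑' s : ℕ, κ i s * X (t - s) ij.2) ij.1

theorem abs_token_apply_le {d : ℕ} {X : TokenSeq d} (hX : ∀ t, ‖X t‖ ≤ 1) (t : ℤ) (j : Fin d) :
    |X t j| ≤ 1 :=
  (PiLp.norm_apply_le (X t) j).trans (hX t)

theorem summable_mul_token {d : ℕ} {X : TokenSeq d} (hX : ∀ t, ‖X t‖ ≤ 1) {κ : ℕ → ℝ}
    (hκ : Summable κ) (t : ℤ) (j : Fin d) : Summable fun s : ℕ => κ s * X (t - s) j := by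
  refine hκ.abs.of_norm_bounded fun s => ?_
  rw [norm_mul, Real.norm_eq_abs]
  exact mul_le_of_le_one_right (abs_nonneg _) (abs_token_apply_le hX _ j)

variable {d M H m : ℕ} (q : Fin H → ℕ) (hq : ∀ h, 2 ≤ q h)

theorem blockTransformer_embed (β : Fin H → Fin (M + 1) → ℝ)
    (w : Fin m → ℝ × BlockVec (M + 1) d × ℝ) (X : TokenSeq d) (t : ℤ)
    (i : Fin (M + 1)) (j : Fin d) :
    (blockTransformer q hq β w).embed X t (finProdFinEquiv (i, j))
      = if i = 0 then X t j else 0 := by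
  simp only [OneLayerTransformer.embed, blockTransformer, Pi.add_apply, Pi.zero_apply, add_zero,
    Matrix.mulVec, dotProduct, Equiv.symm_apply_apply, Prod.mk.injEq, ite_mul, one_mul, zero_mul]
  split_ifs with hi
  · simp [hi]
  · simp [hi]

theorem blockTransformer_WV_mulVec (β : Fin H → Fin (M + 1) → ℝ)
    (w : Fin m → ℝ × BlockVec (M + 1) d × ℝ) (h : Fin H) (v : Fin ((M + 1) * d) → ℝ)
    (i : Fin (M + 1)) (j : Fin d) :
    ((blockTransformer q hq β w).WV h *ᵥ v) (finProdFinEquiv (i, j))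
      = β h i * v (finProdFinEquiv (0, j)) := by
  simp only [blockTransformer, Matrix.mulVec, dotProduct, Equiv.symm_apply_apply, ite_mul,
    zero_mul, Finset.sum_ite_eq', Finset.mem_univ, if_true]

/-- The value matrices carry the softmax normalising sums as factors, which cancel the denominators.
Block `0` receives nothing from attention, so the residual connection leaves the current token
there. -/
theorem blockTransformer_attn (ty : RPEType) (c : Fin M → Fin H → ℝ)
    (w : Fin m → ℝ × BlockVec (M + 1) d × ℝ) {X : TokenSeq d} (hX : ∀ t, ‖X t‖ ≤ 1) (t : ℤ)
    (i : Fin (M + 1)) (j : Fin d) :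
    let θ := blockTransformer q hq
      (fun h => Fin.cons 0 fun i => c i h * ∑' s, rpeBase ty s ^ q h) w
    θ.attn ty (θ.embed X) t (finProdFinEquiv (i, j))
      = Fin.cons (α := fun _ => ℝ) 0
        (fun i => ∑' s : ℕ, (∑ h, c i h * rpeBase ty s ^ q h) * X (t - s) j) i := by
  intro θ
  set β : Fin H → Fin (M + 1) → ℝ :=
    fun h => Fin.cons 0 fun i => c i h * ∑' s, rpeBase ty s ^ q h with hβ
  have hV : ∀ h (s : ℕ) i' j', (θ.WV h *ᵥ θ.embed X (t - s)) (finProdFinEquiv (i', j'))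
      = β h i' * X (t - s) j' := by
    intro h s i' j'
    rw [blockTransformer_WV_mulVec, blockTransformer_embed, if_pos rfl]
  have hw : ∀ h (s : ℕ), θ.attnWeight ty h (θ.embed X) t s
      = rpeBase ty s ^ q h / ∑' j, rpeBase ty j ^ q h := fun h s =>
    attnWeight_eq θ ty rfl (hq h) rfl _ t s
  have hsum : ∀ h, Summable fun s => rpeBase ty s ^ q h := fun h => summable_rpeBase_pow ty (hq h)
  have hterm : ∀ h (i' : Fin (M + 1)) (j' : Fin d), Summable fun s : ℕ =>
      rpeBase ty s ^ q h / (∑' j, rpeBase ty j ^ q h) * (β h i' * X (t - s) j') := by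
    intro h i' j'
    refine (summable_mul_token hX ((hsum h).mul_right ((∑' j, rpeBase ty j ^ q h)⁻¹ * β h i'))
      t j').congr fun s => ?_
    ring
  have hvec : ∀ h, Summable fun s : ℕ => θ.attnWeight ty h (θ.embed X) t s •
      (θ.WV h *ᵥ θ.embed X (t - s)) := by
    intro h
    refine Pi.summable.2 fun a => ?_
    obtain ⟨⟨i', j'⟩, rfl⟩ := finProdFinEquiv.surjective a
    simp only [Pi.smul_apply, hV, hw, smul_eq_mul]
    exact hterm h i' j'
  have hO : θ.WO = 1 := rfl
  rw [OneLayerTransformer.attn, hO, Matrix.one_mulVec, Finset.sum_apply]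
  have hcoord : ∀ h, (∑' s : ℕ, θ.attnWeight ty h (θ.embed X) t s •
      (θ.WV h *ᵥ θ.embed X (t - s))) (finProdFinEquiv (i, j))
      = ∑' s : ℕ, rpeBase ty s ^ q h / (∑' j, rpeBase ty j ^ q h) * (β h i * X (t - s) j) := by
    intro h
    rw [tsum_apply (hvec h)]
    simp only [Pi.smul_apply, hV, hw, smul_eq_mul]
  simp only [hcoord]
  clear hcoord
  refine Fin.cases ?_ (fun i => ?_) i
  · simp [hβ]
  · simp only [hβ, Fin.cons_succ, Finset.sum_mul]
    rw [Summable.tsum_finsetSum fun h _ =>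
      summable_mul_token hX ((hsum h).mul_left (c i h)) t j]
    refine Finset.sum_congr rfl fun h _ => tsum_congr fun s => ?_
    have := (tsum_rpeBase_pow_pos ty (hq h)).ne'
    field_simp

theorem blockTransformer_output (ty : RPEType) (c : Fin M → Fin H → ℝ)
    (w : Fin m → ℝ × BlockVec (M + 1) d × ℝ) {X : TokenSeq d} (hX : ∀ t, ‖X t‖ ≤ 1) (t : ℤ) :
    (blockTransformer q hq (fun h => Fin.cons 0 fun i => c i h * ∑' s, rpeBase ty s ^ q h)
        w).output ty X t
      = ∑ k, (w k).1 * max ((∑ ij, (w k).2.1 ij *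
          filteredVec (fun i s => ∑ h, c i h * rpeBase ty s ^ q h) X t ij) + (w k).2.2) 0 := by
  rw [OneLayerTransformer.output, OneLayerTransformer.ffn]
  refine Finset.sum_congr rfl fun k _ => ?_
  congr 3
  rw [dotProduct, ← finProdFinEquiv.sum_comp]
  refine Finset.sum_congr rfl fun ij _ => ?_
  obtain ⟨i, j⟩ := ij
  rw [Pi.add_apply, blockTransformer_embed, blockTransformer_attn q hq ty c w hX]
  congr 1
  · simp only [blockTransformer, Equiv.symm_apply_apply]
  · refine Fin.cases ?_ (fun i => ?_) i <;> simp [filteredVec]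

theorem blockTransformer_output_mem (ty : RPEType) (β : Fin H → Fin (M + 1) → ℝ)
    (w : Fin m → ℝ × BlockVec (M + 1) d × ℝ) :
    (blockTransformer q hq β w).output ty ∈ dpfTransformers d H m ty := by
  refine ⟨_, _, fun h => ⟨rfl, rfl⟩, fun h => ?_, rfl⟩
  have := tsum_exp_mul_rpe ty (hq h)
  simp only [blockTransformer]
  rw [this]
  exact ENNReal.ofReal_ne_top

end Transformer

/-! ### Block vectors -/

section Blocks

variable {k d : ℕ}

theorem BlockVec.norm_sq_eq (z : BlockVec k d) : ‖z‖ ^ 2 = ∑ i, ∑ j, z (i, j) ^ 2 := by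
  rw [EuclideanSpace.real_norm_sq_eq, Fintype.sum_prod_type]

theorem BlockVec.norm_le_sum {z : BlockVec k d} {r : Fin k → ℝ} (hr : ∀ i, 0 ≤ r i)
    (hz : ∀ i, ∑ j, z (i, j) ^ 2 ≤ r i ^ 2) : ‖z‖ ≤ ∑ i, r i := by
  refine (sq_le_sq₀ (norm_nonneg _) (Finset.sum_nonneg fun i _ => hr i)).1 ?_
  rw [BlockVec.norm_sq_eq]
  exact (Finset.sum_le_sum fun i _ => hz i).trans
    (Finset.sum_sq_le_sq_sum_of_nonneg fun i _ => hr i)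

theorem norm_le_of_mem_blockUnitBalls {z : BlockVec k d} (hz : z ∈ blockUnitBalls k d) :
    ‖z‖ ≤ √k := by
  refine Real.le_sqrt_of_sq_le ?_
  rw [BlockVec.norm_sq_eq]
  exact (Finset.sum_le_sum fun i _ => hz i).trans (by simp)

theorem zero_mem_blockUnitBalls : (0 : BlockVec k d) ∈ blockUnitBalls k d := fun i => by simp

theorem isCompact_blockUnitBalls : IsCompact (blockUnitBalls k d) := by
  refine Metric.isCompact_of_isClosed_isBounded ?_ ?_
  · rw [blockUnitBalls, Set.ofPred_forall]
    exact isClosed_iInter fun i => isClosed_le (by fun_prop) continuous_const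
  · exact (Metric.isBounded_closedBall (x := 0) (r := √k)).subset fun z hz => by
      simpa using norm_le_of_mem_blockUnitBalls hz

/-- The triangle inequality is applied to the series of vectors, not to each coordinate, which keeps
the bound free of `d`. -/
theorem sum_sq_tsum_mul_token_le {X : TokenSeq d} (hX : ∀ t, ‖X t‖ ≤ 1) {κ : ℕ → ℝ}
    (hκ : Summable κ) (t : ℤ) :
    ∑ j, (∑' s : ℕ, κ s * X (t - s) j) ^ 2 ≤ (∑' s, |κ s|) ^ 2 := by
  have hb : ∀ s : ℕ, ‖κ s • X (t - s)‖ ≤ |κ s| := fun s => by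
    rw [norm_smul, Real.norm_eq_abs]
    exact mul_le_of_le_one_right (abs_nonneg _) (hX _)
  have hs : Summable fun s : ℕ => κ s • X (t - s) := hκ.abs.of_norm_bounded hb
  have h1 : ∀ j, ∑' s : ℕ, κ s * X (t - s) j = (∑' s : ℕ, κ s • X (t - s)) j := fun j =>
    ((EuclideanSpace.proj (𝕜 := ℝ) j).map_tsum hs).symm
  simp only [h1]
  rw [← EuclideanSpace.real_norm_sq_eq]
  exact pow_le_pow_left₀ (norm_nonneg _) (tsum_of_norm_bounded hκ.abs.hasSum hb) 2

variable {M : ℕ} {κ : Fin M → ℕ → ℝ} {X : TokenSeq d}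

/-- This is why kernels are normalised to total variation at most `1`: both the network bound and
the Lipschitz bound hold only on `K`. -/
theorem filteredVec_mem_blockUnitBalls (hX : ∀ t, ‖X t‖ ≤ 1) (hκ : ∀ i, Summable (κ i))
    (hκ1 : ∀ i, ∑' s, |κ i s| ≤ 1) (t : ℤ) :
    filteredVec κ X t ∈ blockUnitBalls (M + 1) d := by
  intro i
  refine Fin.cases ?_ (fun i => ?_) i
  · simp only [filteredVec, Fin.cons_zero]
    rw [← EuclideanSpace.real_norm_sq_eq]
    exact pow_le_one₀ (norm_nonneg _) (hX t)
  · simp only [filteredVec, Fin.cons_succ]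
    exact (sum_sq_tsum_mul_token_le hX (hκ i) t).trans
      (pow_le_one₀ (tsum_nonneg fun s => abs_nonneg _) (hκ1 i))

theorem memoryVec_mem_blockUnitBalls (hX : ∀ t, ‖X t‖ ≤ 1) (T : Fin M → ℕ) (t : ℤ) :
    memoryVec T X t ∈ blockUnitBalls (M + 1) d := by
  intro i
  simp only [memoryVec]
  rw [← EuclideanSpace.real_norm_sq_eq]
  exact pow_le_one₀ (norm_nonneg _) (hX _)

/-- Block `i + 1` of the difference is, up to sign, the sequence filtered by `κ i` minus a point
mass at `T i`; block `0` vanishes. -/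
theorem norm_memoryVec_sub_filteredVec_le (hX : ∀ t, ‖X t‖ ≤ 1) (hκ : ∀ i, Summable (κ i))
    (T : Fin M → ℕ) (t : ℤ) :
    ‖memoryVec T X t - filteredVec κ X t‖
      ≤ ∑ i, ∑' s, |κ i s - if s = T i then 1 else 0| := by
  have hδ : ∀ i, Summable fun s => if s = T i then (1 : ℝ) else 0 := fun i =>
    summable_of_ne_finset_zero (s := {T i}) fun s hs => if_neg (by simpa using hs)
  have h0 : ∀ i, 0 ≤ ∑' s, |κ i s - if s = T i then 1 else 0| := fun i =>
    tsum_nonneg fun s => abs_nonneg _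
  refine (BlockVec.norm_le_sum
    (r := Fin.cons 0 fun i => ∑' s, |κ i s - if s = T i then 1 else 0|)
    (fun i => Fin.cases le_rfl (fun i => h0 i) i) fun i => ?_).trans
    (by rw [Fin.sum_univ_succ]; simp)
  refine Fin.cases ?_ (fun i => ?_) i
  · simp [memoryVec, filteredVec, lags]
  · rw [Fin.cons_succ]
    refine le_trans (le_of_eq ?_) (sum_sq_tsum_mul_token_le hX ((hκ i).sub (hδ i)) t)
    refine Finset.sum_congr rfl fun j _ => ?_
    have h1 : ∑' s : ℕ, (if s = T i then (1 : ℝ) else 0) * X (t - s) j = X (t - T i) j := by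
      rw [tsum_eq_single (T i) fun s hs => by rw [if_neg hs, zero_mul], if_pos rfl, one_mul]
    simp only [sub_mul]
    rw [(summable_mul_token hX (hκ i) t j).tsum_sub (summable_mul_token hX (hδ i) t j), h1]
    simp only [PiLp.sub_apply, memoryVec, filteredVec, lags, Fin.cons_succ]
    ring

theorem abs_sub_le_lipNorm_mul {ι : Type} [Fintype ι] {K : Set (EuclideanSpace ℝ ι)}
    {f : EuclideanSpace ℝ ι → ℝ} (hf : ∃ L : ℝ≥0, LipschitzOnWith L f K)
    {x y : EuclideanSpace ℝ ι} (hx : x ∈ K) (hy : y ∈ K) :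
    |f x - f y| ≤ lipNorm K f * ‖x - y‖ := by
  rcases (norm_nonneg (x - y)).eq_or_lt with h | h
  · have : x = y := by rwa [eq_comm, norm_sub_eq_zero_iff] at h
    simp [this]
  · rw [← div_le_iff₀ h]
    have h1 : (|f x - f y| / ‖x - y‖).toNNReal ≤ lipNorm K f := by
      -- Nonemptiness of the set of Lipschitz constants matters here, because `sInf ∅ = 0`.
      refine le_csInf hf fun L hL => ?_
      rw [Real.toNNReal_le_iff_le_coe, div_le_iff₀ h]
      simpa [Real.dist_eq, dist_eq_norm] using hL.dist_le_mul x hx y hy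
    exact Real.toNNReal_le_iff_le_coe.1 h1

end Blocks

/-! ### The attention error -/

section AttentionError

theorem one_le_lagCost (ty : RPEType) {T : ℕ} (hT : 1 ≤ T) : 1 ≤ lagCost ty T := by
  have h1 : (1 : ℝ) ≤ T := by exact_mod_cast hT
  cases ty with
  | lin => exact Real.one_le_exp (by positivity)
  | log => exact Real.one_le_rpow h1 (by norm_num)

theorem le_mul_lagCost (ty : RPEType) {T : ℕ} (hT : 1 ≤ T) : (T : ℝ) ≤ 100 * lagCost ty T := by
  have h1 : (1 : ℝ) ≤ T := by exact_mod_cast hT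
  cases ty with
  | lin =>
    have := Real.add_one_le_exp (0.01 * (T : ℝ))
    simp only [lagCost]
    norm_num at this ⊢
    linarith
  | log =>
    have := Real.self_le_rpow_of_one_le h1 (by norm_num : (1 : ℝ) ≤ 1.01)
    simp only [lagCost]
    linarith

theorem sum_lagCost_pow_le (ty : RPEType) {M : ℕ} {T : Fin M → ℕ} (hT : ∀ i, 1 ≤ T i) (n : ℕ) :
    ∑ i, lagCost ty (T i) ^ (n + 1) ≤ (∑ i, lagCost ty (T i)) ^ (n + 1) := by
  have h0 : ∀ i, 0 ≤ lagCost ty (T i) := fun i => zero_le_one.trans (one_le_lagCost ty (hT i))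
  rw [pow_succ, Finset.mul_sum]
  refine Finset.sum_le_sum fun i hi => ?_
  rw [pow_succ]
  exact mul_le_mul_of_nonneg_right
    (pow_le_pow_left₀ (h0 i) (Finset.single_le_sum (fun i _ => h0 i) hi) n) (h0 i)

/-- With `H` shared heads, each lag `T` is selected with error `O(lagCost^{n+1} / H^n)`. -/
theorem exists_exponent_forall_attention_error (ty : RPEType) {H : ℕ} (hH : 1 ≤ H) (n : ℕ) :
    ∃ P : ℕ, 2 ≤ P ∧ ∀ T, 1 ≤ T → ∃ c : Fin H → ℝ,
      ∑' s, |∑ h, c h * rpeBase ty s ^ (P * (h + 1))| ≤ 1 ∧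
      ∑' s, |(∑ h, c h * rpeBase ty s ^ (P * (h + 1))) - if s = T then 1 else 0|
        ≤ 100 ^ n / (H : ℝ) ^ n * lagCost ty T ^ (n + 1) := by
  have hH0 : (0 : ℝ) < H := by exact_mod_cast hH
  obtain ⟨P, hP, hker⟩ := exists_exponent_forall_kernel ty H
    (δ := 100 ^ n / (H : ℝ) ^ n) (by positivity)
  refine ⟨P, hP, fun T hT => ?_⟩
  have hcost := one_le_lagCost ty hT
  -- Lags below `H` are selected with error `δ`, chosen as the target bound without its lag factor.
  -- Longer lags are dropped, at cost `1`.
  rcases lt_or_ge T H with hTH | hTH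
  · obtain ⟨c, h1, h2⟩ := hker T hT hTH
    exact ⟨c, h1, h2.trans (le_mul_of_one_le_right (by positivity) (one_le_pow₀ hcost))⟩
  · refine ⟨0, by simp, ?_⟩
    have h1 : ∑' s, |(∑ h : Fin H, (0 : Fin H → ℝ) h * rpeBase ty s ^ (P * ((h : ℕ) + 1)))
        - if s = T then 1 else 0| = 1 := by
      rw [tsum_eq_single T fun s hs => by simp [hs]]
      simp
    rw [h1, div_mul_eq_mul_div, le_div_iff₀ (by positivity), one_mul]
    calc (H : ℝ) ^ n ≤ (100 * lagCost ty T) ^ n :=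
          pow_le_pow_left₀ hH0.le
            ((by exact_mod_cast hTH : (H : ℝ) ≤ T).trans (le_mul_lagCost ty hT)) n
      _ = 100 ^ n * lagCost ty T ^ n := mul_pow _ _ _
      _ ≤ 100 ^ n * lagCost ty T ^ (n + 1) :=
          mul_le_mul_of_nonneg_left (pow_le_pow_right₀ hcost (Nat.le_succ n)) (by positivity)

end AttentionError

/-! ### Assembly of the two error terms -/

theorem mainTheorem4 :
    ∃ (A : ℝ) (κ : ℕ) (C : ℕ → ℝ), 0 < A ∧ (∀ n, 0 < C n) ∧
      ∀ (ty : RPEType) (d M : ℕ) (T : Fin M → ℕ), (∀ i, 1 ≤ T i) → StrictMono T →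
      ∀ (𝒳 : Set (TokenSeq d)), (∀ X ∈ 𝒳, ∀ t, ‖X t‖ ≤ 1) →
      ∀ (p : ℝ≥0∞), 1 ≤ p →
      ∀ (f : BlockVec (M + 1) d → ℝ), MemBarron p (blockUnitBalls (M + 1) d) f →
      (∃ L : ℝ≥0, LipschitzOnWith L f (blockUnitBalls (M + 1) d)) →
      ∀ (n H m : ℕ), 1 ≤ n → 1 ≤ H → 1 ≤ m →
      ∃ TF ∈ dpfTransformers d H m ty,
        seqDist 𝒳 (fixedMemoryTarget T f) TF ≤ ENNReal.ofReal
          (A * √((M : ℝ) + 1) * (1 + Real.log m) ^ κ *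
              ((barronNorm p (blockUnitBalls (M + 1) d) f).toReal / √(m : ℝ))
            + (lipNorm (blockUnitBalls (M + 1) d) f : ℝ) *
              (C n / (H : ℝ) ^ n * (∑ i, lagCost ty (T i)) ^ (n + 1))) := by
  -- The exponent `0` is possible since the halving argument produces no logarithm; `100 ^ n` comes
  -- from `T ≤ 100 * lagCost ty T`.
  refine ⟨36, 0, fun n => 100 ^ n, by norm_num, fun n => by positivity, ?_⟩
  intro ty d M T hT _ 𝒳 h𝒳 p hp f hf hLip n H m _ hH hm
  set K := blockUnitBalls (M + 1) d
  have : CompactSpace K := isCompact_iff_compactSpace.1 isCompact_blockUnitBalls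
  obtain ⟨w, hw⟩ := exists_network_near_barron (K := K) zero_mem_blockUnitBalls
    (R := √((M : ℝ) + 1)) (Real.one_le_sqrt.2 (by simp))
    (fun z hz => by simpa using norm_le_of_mem_blockUnitBalls hz) hp hf.2 hm
  obtain ⟨P, hP, hker⟩ := exists_exponent_forall_attention_error ty hH n
  choose c hc₁ hc₂ using fun i => hker (T i) (hT i)
  have hq : ∀ h : Fin H, 2 ≤ P * ((h : ℕ) + 1) := fun h =>
    hP.trans (Nat.le_mul_of_pos_right P (Nat.succ_pos _))
  refine ⟨_, blockTransformer_output_mem (fun h : Fin H => P * ((h : ℕ) + 1)) hq ty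
    (fun h => Fin.cons 0 fun i => c i h * ∑' s, rpeBase ty s ^ (P * ((h : ℕ) + 1))) w, ?_⟩
  refine iSup_le fun t => iSup_le fun X => iSup_le fun hX => ?_
  have hX1 := h𝒳 X hX
  rw [blockTransformer_output (fun h : Fin H => P * ((h : ℕ) + 1)) hq ty c w hX1,
    Real.enorm_eq_ofReal_abs]
  refine ENNReal.ofReal_le_ofReal ?_
  have hκ : ∀ i, Summable fun s => ∑ h, c i h * rpeBase ty s ^ (P * ((h : ℕ) + 1)) := fun i =>
    summable_sum fun h _ => (summable_rpeBase_pow ty (hq h)).mul_left _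
  set y := filteredVec (fun i s => ∑ h, c i h * rpeBase ty s ^ (P * ((h : ℕ) + 1))) X t
  have hy : y ∈ K := filteredVec_mem_blockUnitBalls hX1 hκ hc₁ t
  have hz : memoryVec T X t ∈ K := memoryVec_mem_blockUnitBalls hX1 T t
  have hyz : ‖memoryVec T X t - y‖
      ≤ 100 ^ n / (H : ℝ) ^ n * (∑ i, lagCost ty (T i)) ^ (n + 1) := by
    refine (norm_memoryVec_sub_filteredVec_le hX1 hκ T t).trans
      ((Finset.sum_le_sum fun i _ => hc₂ i).trans ?_)
    rw [← Finset.mul_sum]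
    exact mul_le_mul_of_nonneg_left (sum_lagCost_pow_le ty hT n) (by positivity)
  have h1 := abs_sub_le_lipNorm_mul hLip hz hy
  have h2 := mul_le_mul_of_nonneg_left hyz (lipNorm K f).coe_nonneg
  have h3 := hw y hy
  rw [pow_zero, mul_one]
  refine (abs_sub_le _ (f y) _).trans ?_
  rw [fixedMemoryTarget]
  linarith
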